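/- Notation. Let $\langle u,v\rangle=\int_{\mathbb R^d}u\,\overline{v}\,dx$ and $\|\cdot\|$ be the inner product and norm of $L^2(\mathbb R^d,\mathbb C)$. For an operator $A:D(A)\to L^2(\mathbb R^d,\mathbb C)$ put $\|u\|_A=\|u\|+\|Au\|$; balls in $D(A)$ are taken in this norm. For $W:\mathbb R^d\times\mathbb C\to\mathbb C$ put $L(\cdot,\omega)=A-W(\cdot,\omega)$ with domain $D(A)$. Assumptions. Let $\omega_0\in\mathbb C$, $\varphi_0\in D(A)$, and let $\delta,\alpha,\beta,\lambda_0>0$. (A1) $A$ is densely defined and closed and has a non-empty resolvent set. (A2) $D(A)\hookrightarrow L^\infty(\mathbb R^d,\mathbb C)$ continuously. (W1) $W(x,\cdot)$ is holomorphic on $B_\delta(\omega_0)$ for a.e. $x$, and $\|W(\cdot,\omega)\|_\infty\le c$ for some $c>0$ and all $\omega\in B_\delta(\omega_0)$. (E) $\omega_0$ is an algebraically simple eigenvalue, i.e. $\ker L(\cdot,\omega_0)^2=\ker L(\cdot,\omega_0)=\mathrm{span}\{\varphi_0\}$; it is isolated, i.e. for some $\rho>0$ and all $\omega\in B_\rho(\omega_0)$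 one has $0\in\sigma(L(\cdot,\omega))$ if and only if $\omega=\omega_0$; and $L(\cdot,\omega_0)$ has closed range. Moreover $\varphi_0^*$ is an eigenfunction of the adjoint, $L(\cdot,\omega_0)^*\varphi_0^*=0$, normalized together with $\varphi_0$ by $\|\varphi_0\|=1$, $\langle\varphi_0,\varphi_0^*\rangle=1$. (Wt) $\langle\partial_\omega W(\cdot,\omega_0)\varphi_0,\varphi_0^*\rangle\ne0$. The function $f:\mathbb R^d\times\mathbb C\times\mathbb C\to\mathbb C$ satisfies: (f1) $f(\cdot,\omega,\varphi(\cdot))\in L^2(\mathbb R^d,\mathbb C)$ for all $\omega\in B_\delta(\omega_0)$ and $\varphi\in B_\delta(0)\subset D(A)$. (f2) There is $K>0$ with $\|f(\cdot,\omega_1,\lambda\varphi)-f(\cdot,\omega_2,\lambda\varphi)\|\le K\lambda^{\frac1\alpha+1}|\omega_1-\omega_2|$ for all $\lambda\in(0,\lambda_0)$, $\omega_1,\omega_2\in B_\delta(\omega_0)$, $\varphi\in B_\delta(\varphi_0)\subset D(A)$. (f3) There is $K>0$ with $\|f(\cdot,\omega,\lambda\varphi_1)-f(\cdot,\omega,\lambda\varphi_2)\|\le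 K\lambda^{\frac1\alpha+1}\|\varphi_1-\varphi_2\|$ for all $\lambda\in(0,\lambda_0)$, $\varphi_1,\varphi_2\in B_\delta(\varphi_0)\subset D(A)$, $\omega\in B_\delta(\omega_0)$. (f4) For every $\omega\in B_\delta(\omega_0)$ there is $g_\omega\in L^\infty(\mathbb R^d,\mathbb C)\setminus\{0\}$ such that $f(x,\omega,z)-g_\omega(x)|z|^{\frac1\alpha}z=O(|z|^{\frac1\alpha+1+\beta})$ as $\mathbb C\ni z\to0$, uniformly in $\omega\in B_\delta(\omega_0)$ and in a.e. $x$, and $\|g_{\omega_1}-g_{\omega_2}\|_\infty\le K|\omega_1-\omega_2|$ for some $K>0$ and all $\omega_1,\omega_2\in B_\delta(\omega_0)$. Theorem. Put $$\nu=-\frac{\langle g_{\omega_0}|\varphi_0|^{\frac1\alpha}\varphi_0,\varphi_0^*\rangle}{\langle\partial_\omega W(\cdot,\omega_0)\varphi_0,\varphi_0^*\rangle}.$$ There is exactly one $\phi\in D(A)$ with $\langle\phi,\varphi_0^*\rangle=0$ and $L(\cdot,\omega_0)\phi=g_{\omega_0}|\varphi_0|^{\frac1\alpha}\varphi_0+\nu\,\partial_\omega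 W(\cdot,\omega_0)\varphi_0$. With these $\nu$ and $\phi$, for every $\tau\in(0,\min\{1,\alpha\beta\}]$ there are $r_1,r_2,\varepsilon_0>0$ such that for every $\varepsilon\in(0,\varepsilon_0)$ the problem $$L(\cdot,\omega)\varphi=f(\cdot,\omega,\varphi),\qquad\langle\varphi,\varphi_0^*\rangle=\varepsilon^\alpha,$$ has exactly one solution $(\omega,\varphi)\in\mathbb C\times D(A)$ of the form $$\omega=\omega_0+\varepsilon\nu+\varepsilon^{1+\tau}\sigma,\qquad\varphi=\varepsilon^\alpha\varphi_0+\varepsilon^{\alpha+1}\phi+\varepsilon^{\alpha+1+\tau}\psi$$ with $\sigma\in\mathbb C$, $|\sigma|<r_1$, and $\psi\in D(A)$, $\langle\psi,\varphi_0^*\rangle=0$, $\|\psi\|_A<r_2$. -/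

import Mathlib

open MeasureTheory
open scoped ENNReal LinearPMap

namespace NLEig

noncomputable section

/-- The space `ℝ^d`. -/
abbrev Rd (d : ℕ) : Type := EuclideanSpace ℝ (Fin d)

/-- The complex Hilbert space `L²(ℝ^d, ℂ)`. -/
abbrev L2 (d : ℕ) : Type := Lp ℂ 2 (volume : Measure (Rd d))

/-- Unbounded linear operators `L²(ℝ^d, ℂ) ⊇ D(T) → L²(ℝ^d, ℂ)`. -/
abbrev Op (d : ℕ) : Type := L2 d →ₗ.[ℂ] L2 d

/-- The pairing `⟨u, v⟩ = ∫ u v̄` of `L²(ℝ^d, ℂ)`, linear in the FIRST argument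
(Mathlib's `inner` is linear in the second one). -/
def pair {d : ℕ} (u v : L2 d) : ℂ := inner ℂ v u

open Classical in
/-- The bounded multiplication operator `u ↦ w u` on `L²(ℝ^d, ℂ)` for `w ∈ L^∞(ℝ^d, ℂ)`
(zero if `w` is not in `L^∞`). -/
def mulOp {d : ℕ} (w : Rd d → ℂ) : L2 d →L[ℂ] L2 d :=
  if h : MemLp w ∞ (volume : Measure (Rd d)) then
    (ContinuousLinearMap.mul ℂ ℂ).holderL volume ∞ 2 2 (h.toLp w)
  else 0

theorem mulOp_coeFn {d : ℕ} {w : Rd d → ℂ} (h : MemLp w ∞ (volume : Measure (Rd d)))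
    (u : L2 d) : (mulOp w u : Rd d → ℂ) =ᵐ[volume] fun x => w x * u x := by
  rw [mulOp, dif_pos h]
  refine ((ContinuousLinearMap.mul ℂ ℂ).coeFn_holder (r := 2) (h.toLp w) u).trans ?_
  filter_upwards [h.coeFn_toLp] with x hx
  simp [hx]

/-- The operator `L(·, ω) = A - W(·, ω)` with domain `D(A)`. -/
def linOp {d : ℕ} (A : Op d) (W : Rd d → ℂ → ℂ) (ω : ℂ) : Op d where
  domain := A.domain
  toFun := A.toFun - (mulOp fun x => W x ω).toLinearMap ∘ₗ A.domain.subtype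

/-- `z` belongs to the resolvent set of `T`: the operator `T - z : D(T) → L²` has a bounded,
everywhere defined two-sided inverse. -/
def InResolvent {d : ℕ} (T : Op d) (z : ℂ) : Prop :=
  ∃ R : L2 d →L[ℂ] L2 d,
    (∀ v : L2 d, ∃ h : R v ∈ T.domain, T ⟨R v, h⟩ - z • R v = v) ∧
    (∀ u : T.domain, R (T u - z • (u : L2 d)) = u)

/-- `z` belongs to the spectrum of `T`. -/
def InSpectrum {d : ℕ} (T : Op d) (z : ℂ) : Prop := ¬ InResolvent T z

/-- The graph norm `‖u‖_A = ‖u‖ + ‖A u‖` on `D(A)`. -/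
def graphNorm {d : ℕ} (A : Op d) (u : A.domain) : ℝ := ‖(u : L2 d)‖ + ‖A u‖

/-- `ker T = ker T² = ⟨φ₀⟩`, where `D(T²) = {u ∈ D(T) : T u ∈ D(T)}`. -/
def AlgSimple {d : ℕ} (T : Op d) (φ₀ : L2 d) : Prop :=
  {u : L2 d | ∃ h : u ∈ T.domain, T ⟨u, h⟩ = 0} = (Submodule.span ℂ {φ₀} : Set (L2 d)) ∧
  {u : L2 d | ∃ (h : u ∈ T.domain) (h' : T ⟨u, h⟩ ∈ T.domain), T ⟨T ⟨u, h⟩, h'⟩ = 0} =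
    (Submodule.span ℂ {φ₀} : Set (L2 d))

/-- `ω₀` is isolated: near `ω₀`, zero is in the spectrum of `L(·, ω)` if and only if `ω = ω₀`. -/
def Isolated {d : ℕ} (A : Op d) (W : Rd d → ℂ → ℂ) (ω₀ : ℂ) : Prop :=
  ∃ ρ > 0, ∀ ω ∈ Metric.ball ω₀ ρ, InSpectrum (linOp A W ω) 0 ↔ ω = ω₀

/-- `A` is closed, densely defined and has a non-empty resolvent set. -/
def HypA1 {d : ℕ} (A : Op d) : Prop :=
  Dense (A.domain : Set (L2 d)) ∧ A.IsClosed ∧ ∃ z, InResolvent A z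

/-- `D(A)` with the graph norm embeds continuously into `L^∞`. -/
def HypA2 {d : ℕ} (A : Op d) : Prop :=
  ∃ C : ℝ, ∀ u : A.domain,
    eLpNorm ((u : L2 d) : Rd d → ℂ) ∞ volume ≤ ENNReal.ofReal (C * graphNorm A u)

/-- `W(x, ·)` is holomorphic on `B_δ(ω₀)` for a.e. `x`, and `W(·, ω)` is bounded in `L^∞`
uniformly in `ω ∈ B_δ(ω₀)`. -/
def HypW1 {d : ℕ} (W : Rd d → ℂ → ℂ) (ω₀ : ℂ) (δ : ℝ) : Prop :=
  (∀ᵐ x : Rd d, DifferentiableOn ℂ (W x) (Metric.ball ω₀ δ)) ∧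
  ∃ c > 0, ∀ ω ∈ Metric.ball ω₀ δ,
    AEStronglyMeasurable (fun x => W x ω) volume ∧
    eLpNorm (fun x => W x ω) ∞ volume ≤ ENNReal.ofReal c

/-- The function `∂_ω W(·, ω₀)`. -/
def dW {d : ℕ} (W : Rd d → ℂ → ℂ) (ω₀ : ℂ) : Rd d → ℂ := fun x => deriv (W x) ω₀

/-- The superposition `f(·, ω, φ(·))` is in `L²` for `ω ∈ B_δ(ω₀)` and `φ ∈ B_δ(0) ⊆ D(A)`. -/
def HypF1 {d : ℕ} (A : Op d) (f : Rd d → ℂ → ℂ → ℂ) (ω₀ : ℂ) (δ : ℝ) : Prop :=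
  ∀ ω ∈ Metric.ball ω₀ δ, ∀ φ : A.domain, graphNorm A φ < δ →
    MemLp (fun x => f x ω ((φ : L2 d) x)) 2 volume

/-- Lipschitz continuity of `f` in `ω`. -/
def HypF2 {d : ℕ} (A : Op d) (f : Rd d → ℂ → ℂ → ℂ) (ω₀ : ℂ) (φ₀ : A.domain)
    (δ α lam₀ : ℝ) : Prop :=
  ∃ K > 0, ∀ lam ∈ Set.Ioo 0 lam₀,
    ∀ ω₁ ∈ Metric.ball ω₀ δ, ∀ ω₂ ∈ Metric.ball ω₀ δ,
    ∀ φ : A.domain, graphNorm A (φ - φ₀) < δ →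
      eLpNorm (fun x => f x ω₁ (lam * (φ : L2 d) x) - f x ω₂ (lam * (φ : L2 d) x)) 2 volume
        ≤ ENNReal.ofReal (K * lam ^ (1 / α + 1) * ‖ω₁ - ω₂‖)

/-- Lipschitz continuity of `f` in `φ`. -/
def HypF3 {d : ℕ} (A : Op d) (f : Rd d → ℂ → ℂ → ℂ) (ω₀ : ℂ) (φ₀ : A.domain)
    (δ α lam₀ : ℝ) : Prop :=
  ∃ K > 0, ∀ lam ∈ Set.Ioo 0 lam₀,
    ∀ φ₁ : A.domain, graphNorm A (φ₁ - φ₀) < δ →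
    ∀ φ₂ : A.domain, graphNorm A (φ₂ - φ₀) < δ →
    ∀ ω ∈ Metric.ball ω₀ δ,
      eLpNorm (fun x => f x ω (lam * (φ₁ : L2 d) x) - f x ω (lam * (φ₂ : L2 d) x)) 2 volume
        ≤ ENNReal.ofReal (K * lam ^ (1 / α + 1) * ‖(φ₁ : L2 d) - (φ₂ : L2 d)‖)

/-- `g_ω ∈ L^∞ \ {0}`; `f(x, ω, z) - g_ω(x)|z|^{1/α} z = O(|z|^{1/α+1+β})` as `z → 0`, uniformly
in `ω ∈ B_δ(ω₀)` and (up to null sets) in `x`; and `ω ↦ g_ω ∈ L^∞` is Lipschitz. -/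
def HypF4 {d : ℕ} (f : Rd d → ℂ → ℂ → ℂ) (g : ℂ → Rd d → ℂ) (ω₀ : ℂ) (δ α β : ℝ) : Prop :=
  (∀ ω ∈ Metric.ball ω₀ δ, MemLp (g ω) ∞ volume ∧ ¬ g ω =ᵐ[volume] 0) ∧
  (∃ C : ℝ, ∃ r > 0, ∀ ω ∈ Metric.ball ω₀ δ, ∀ᵐ x : Rd d, ∀ z : ℂ, ‖z‖ < r →
    ‖f x ω z - g ω x * ((‖z‖ ^ (1 / α) : ℝ) : ℂ) * z‖ ≤ C * ‖z‖ ^ (1 / α + 1 + β)) ∧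
  ∃ K > 0, ∀ ω₁ ∈ Metric.ball ω₀ δ, ∀ ω₂ ∈ Metric.ball ω₀ δ,
    eLpNorm (fun x => g ω₁ x - g ω₂ x) ∞ volume ≤ ENNReal.ofReal (K * ‖ω₁ - ω₂‖)

/-- The element `g |φ|^{1/α} φ` of `L²`, for `g ∈ L^∞` and `φ ∈ L² ∩ L^∞`. -/
def leading {d : ℕ} (g : Rd d → ℂ) (α : ℝ) (φ : L2 d) : L2 d :=
  mulOp (fun x => g x * ((‖φ x‖ ^ (1 / α) : ℝ) : ℂ)) φ

/-- `ν = - ⟨g_{ω₀}|φ₀|^{1/α} φ₀, φ₀*⟩ / ⟨∂_ω W(·, ω₀) φ₀, φ₀*⟩`. -/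
def nu {d : ℕ} (W : Rd d → ℂ → ℂ) (g : ℂ → Rd d → ℂ) (α : ℝ) (ω₀ : ℂ) (φ₀ φs : L2 d) : ℂ :=
  - pair (leading (g ω₀) α φ₀) φs / pair (mulOp (dW W ω₀) φ₀) φs

/-- `(ω, φ) ∈ ℂ × D(A)` solves `L(·, ω) φ = f(·, ω, φ)`. -/
def Solves {d : ℕ} (A : Op d) (W : Rd d → ℂ → ℂ) (f : Rd d → ℂ → ℂ → ℂ)
    (ω : ℂ) (φ : L2 d) : Prop :=
  ∃ h : φ ∈ (linOp A W ω).domain,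
    (linOp A W ω ⟨φ, h⟩ : Rd d → ℂ) =ᵐ[volume] fun x => f x ω (φ x)

/-- `ω = ω₀ + εν + ε^{1+τ}σ` and `φ = ε^α φ₀ + ε^{α+1} ϕ + ε^{α+1+τ} ψ` for some `σ ∈ B_{r₁}(0) ⊆ ℂ`
and some `ψ ∈ B_{r₂}(0) ⊆ D(A)` with `⟨ψ, φ₀*⟩ = 0`. -/
def HasExpansion {d : ℕ} (A : Op d) (ω₀ ν : ℂ) (φ₀ φs ϕ : L2 d) (α τ r₁ r₂ ε : ℝ)
    (ω : ℂ) (φ : L2 d) : Prop :=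
  ∃ (σ : ℂ) (ψ : A.domain), ‖σ‖ < r₁ ∧ graphNorm A ψ < r₂ ∧ pair (ψ : L2 d) φs = 0 ∧
    ω = ω₀ + (ε : ℂ) * ν + ((ε ^ (1 + τ) : ℝ) : ℂ) * σ ∧
    φ = ((ε ^ α : ℝ) : ℂ) • φ₀ + ((ε ^ (α + 1) : ℝ) : ℂ) • ϕ +
      ((ε ^ (α + 1 + τ) : ℝ) : ℂ) • (ψ : L2 d)

end

end NLEig

namespace NLEig

/-! This is a Lyapunov–Schmidt reduction followed by a contraction argument. Write `L₀ = L(·, ω₀)`,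
`w = ∂_ω W(·, ω₀) φ₀` and `φ = ε^α u` with `u = φ₀ + εϕ + ε^{1+τ}ψ`. After division by `ε^α` the
equation reads `L₀ u = (W(·, ω) - W(·, ω₀)) u + ε^{-α} f(·, ω, ε^α u)`, with leading right-hand side
`(ω - ω₀) w + ε g_{ω₀}|φ₀|^{1/α} φ₀`. The order `ε` gives the equation for `ϕ`; it is solvable
because `ν` makes its right-hand side orthogonal to `φ₀*`. What is left is `L₀ ψ = σ w + ε^{-1-τ}
P_ε(ω, u)`, with `P_ε` the `remainder`.

The linear part rests on `range L₀ = ⟨φ₀*⟩^⊥` (`exists_linOp_eq`). Since `⟨w, φ₀*⟩ ≠ 0`, the system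
`L₀ ψ = σ w + h`, `ψ ⊥ φ₀*`, then determines `(σ, ψ)` as a Lipschitz function of `h`
(`exists_bordered_solver`).

The nonlinear part rests on `exists_remainder_bounds`: `P_ε` has Lipschitz constant `O(ε)` at
distance `O(ε)` from `(ω₀, φ₀)`, and `P_ε(ω₀, φ₀) = O(ε^{1+αβ})`. Hence `P_ε = O(ε² + ε^{1+αβ})`
there, which is `O(ε^{1+τ})` exactly because `τ ≤ min(1, αβ)`. As `(ω, u)` moves by `ε^{1+τ}` times
the change in `(σ, ψ)`, the scaled remainder has Lipschitz constant `O(ε)`, and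
`existsUnique_scaled_solution` concludes by Banach's theorem. -/

/-! ### Multiplication operators and the Taylor expansion of the potential in `ω`. -/

theorem norm_mulOp_le {d : ℕ} {w : Rd d → ℂ} {c : ℝ} (hc : 0 ≤ c)
    (h : ∀ᵐ x : Rd d, ‖w x‖ ≤ c) : ‖mulOp w‖ ≤ c := by
  by_cases hw : MemLp w ∞ (volume : Measure (Rd d))
  · refine ContinuousLinearMap.opNorm_le_bound _ hc fun u => ?_
    refine Lp.norm_le_mul_norm_of_ae_le_mul ?_
    filter_upwards [mulOp_coeFn hw u, h] with x hx hx'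
    rw [hx, norm_mul]
    gcongr
  · simpa [mulOp, hw] using hc

theorem mulOp_sub_sub_smul {d : ℕ} {w₁ w₂ w₃ : Rd d → ℂ} (z : ℂ)
    (h₁ : MemLp w₁ ∞ (volume : Measure (Rd d))) (h₂ : MemLp w₂ ∞ (volume : Measure (Rd d)))
    (h₃ : MemLp w₃ ∞ (volume : Measure (Rd d))) :
    mulOp w₁ - mulOp w₂ - z • mulOp w₃ = mulOp fun x => w₁ x - w₂ x - z * w₃ x := by
  have h₄ : MemLp (fun x => w₁ x - w₂ x - z * w₃ x) ∞ (volume : Measure (Rd d)) :=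
    (h₁.sub h₂).sub (h₃.const_mul z)
  refine ContinuousLinearMap.ext fun u => Lp.ext ?_
  simp only [sub_apply, smul_apply]
  filter_upwards [mulOp_coeFn h₁ u, mulOp_coeFn h₂ u, mulOp_coeFn h₃ u, mulOp_coeFn h₄ u,
    Lp.coeFn_sub (mulOp w₁ u - mulOp w₂ u) (z • mulOp w₃ u),
    Lp.coeFn_sub (mulOp w₁ u) (mulOp w₂ u), Lp.coeFn_smul z (mulOp w₃ u)]
    with x e₁ e₂ e₃ e₄ e₅ e₆ e₇
  rw [e₅, Pi.sub_apply, e₆, Pi.sub_apply, e₇, Pi.smul_apply, e₁, e₂, e₃, e₄, smul_eq_mul]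
  ring

/-- The exceptional null set in the bound on `W(·, ω)` can be chosen independently of `ω`. -/
theorem HypW1.ae_bound {d : ℕ} {W : Rd d → ℂ → ℂ} {ω₀ : ℂ} {δ : ℝ} (h : HypW1 W ω₀ δ) :
    ∃ c > 0, ∀ᵐ x : Rd d, DifferentiableOn ℂ (W x) (Metric.ball ω₀ δ) ∧
      ∀ ω ∈ Metric.ball ω₀ δ, ‖W x ω‖ ≤ c := by
  obtain ⟨hd, c, hc, hb⟩ := h
  refine ⟨c, hc, ?_⟩
  -- Countably many null sets are discarded, one for each `ω` in a countable dense set; continuity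
  -- of `W x` carries the bound to the whole ball.
  obtain ⟨s, hs, hsd⟩ := TopologicalSpace.exists_countable_dense ℂ
  have hball : ∀ᵐ x : Rd d, ∀ ω ∈ s, ω ∈ Metric.ball ω₀ δ → ‖W x ω‖ ≤ c := by
    rw [ae_ball_iff hs]
    intro ω _
    by_cases hω : ω ∈ Metric.ball ω₀ δ
    · have h1 := (hb ω hω).2
      rw [eLpNorm_exponent_top] at h1
      filter_upwards [ae_le_eLpNormEssSup (f := fun x => W x ω) (μ := volume)] with x hx _
      have := hx.trans h1
      rw [← ofReal_norm] at this
      exact (ENNReal.ofReal_le_ofReal_iff hc.le).1 this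
    · exact Filter.Eventually.of_forall fun x h => absurd h hω
  filter_upwards [hd, hball] with x hx hx'
  refine ⟨hx, fun ω hω => ?_⟩
  by_contra! hlt
  have ho : IsOpen (Metric.ball ω₀ δ ∩ W x ⁻¹' {z | c < ‖z‖}) :=
    hx.continuousOn.isOpen_inter_preimage Metric.isOpen_ball
      (isOpen_lt continuous_const continuous_norm)
  obtain ⟨ω', ⟨h1, h2⟩, h3⟩ := hsd.inter_open_nonempty _ ho ⟨ω, hω, hlt⟩
  exact absurd (hx' ω' h3 h1) (not_le.2 h2)

/-- Cauchy estimate for the derivative at the centre. -/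
theorem norm_deriv_le_of_norm_le {h : ℂ → ℂ} {ω₀ : ℂ} {δ c r : ℝ} (hr : 0 < r) (hrδ : r < δ)
    (hd : DifferentiableOn ℂ h (Metric.ball ω₀ δ)) (hb : ∀ ω ∈ Metric.ball ω₀ δ, ‖h ω‖ ≤ c) :
    ‖deriv h ω₀‖ ≤ c / r := by
  refine Complex.norm_deriv_le_of_forall_mem_sphere_norm_le hr ?_ fun z hz => hb z ?_
  · refine (hd.mono ?_).diffContOnCl
    rw [closure_ball _ hr.ne']
    exact Metric.closedBall_subset_ball hrδ
  · exact Metric.closedBall_subset_ball hrδ (Metric.sphere_subset_closedBall hz)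

/-- First-order Taylor expansion of a bounded holomorphic function, in Lipschitz form. -/
theorem norm_sub_sub_mul_deriv_le {h : ℂ → ℂ} {ω₀ : ℂ} {δ c R : ℝ} (hδ : 0 < δ)
    (hR : R ≤ δ / 4)
    (hd : DifferentiableOn ℂ h (Metric.ball ω₀ δ)) (hb : ∀ ω ∈ Metric.ball ω₀ δ, ‖h ω‖ ≤ c)
    {ω₁ ω₂ : ℂ} (h₁ : ω₁ ∈ Metric.closedBall ω₀ R) (h₂ : ω₂ ∈ Metric.closedBall ω₀ R) :
    ‖h ω₁ - h ω₂ - (ω₁ - ω₂) * deriv h ω₀‖ ≤ c / (δ / 4) / (δ / 4) * R * ‖ω₁ - ω₂‖ := by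
  have hc : 0 ≤ c := (norm_nonneg _).trans (hb ω₀ (Metric.mem_ball_self hδ))
  have hR0 : 0 ≤ R := dist_nonneg.trans h₁
  -- Cauchy's estimate with radius `δ/4` is applied to `h` and then to `h'`. Room `3δ/8 > δ/4` is
  -- available both times: `δ/4 + 3δ/8 = 5δ/8` and `5δ/8 + 3δ/8 = δ`.
  have hsub : ∀ ω ∈ Metric.ball ω₀ (5 * δ / 8), Metric.ball ω (3 * δ / 8) ⊆ Metric.ball ω₀ δ := by
    intro ω hω
    refine Metric.ball_subset_ball' ?_
    have := Metric.mem_ball.1 hω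
    linarith
  have hsub' : ∀ ω ∈ Metric.closedBall ω₀ R,
      Metric.ball ω (3 * δ / 8) ⊆ Metric.ball ω₀ (5 * δ / 8) := by
    intro ω hω
    refine Metric.ball_subset_ball' ?_
    have := Metric.mem_closedBall.1 hω
    linarith
  have hin : Metric.closedBall ω₀ R ⊆ Metric.ball ω₀ δ :=
    Metric.closedBall_subset_ball (by linarith)
  have hd' : DifferentiableOn ℂ (deriv h) (Metric.ball ω₀ δ) := hd.deriv Metric.isOpen_ball
  have hb1 : ∀ ω ∈ Metric.ball ω₀ (5 * δ / 8), ‖deriv h ω‖ ≤ c / (δ / 4) := fun ω hω =>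
    norm_deriv_le_of_norm_le (by linarith) (by linarith) (hd.mono (hsub ω hω))
      fun z hz => hb z (hsub ω hω hz)
  have hb2 : ∀ ω ∈ Metric.closedBall ω₀ R, ‖deriv (deriv h) ω‖ ≤ c / (δ / 4) / (δ / 4) :=
    fun ω hω => norm_deriv_le_of_norm_le (by linarith) (by linarith)
      (hd'.mono ((hsub' ω hω).trans (Metric.ball_subset_ball (by linarith))))
      fun z hz => hb1 z (hsub' ω hω hz)
  have hconv := convex_closedBall ω₀ R
  have hdiff : ∀ ω ∈ Metric.closedBall ω₀ R, DifferentiableAt ℂ h ω := fun ω hω =>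
    hd.differentiableAt (Metric.isOpen_ball.mem_nhds (hin hω))
  have hderiv : ∀ ω ∈ Metric.closedBall ω₀ R,
      ‖deriv h ω - deriv h ω₀‖ ≤ c / (δ / 4) / (δ / 4) * R := by
    intro ω hω
    refine (hconv.norm_image_sub_le_of_norm_deriv_le (fun z hz => hd'.differentiableAt
      (Metric.isOpen_ball.mem_nhds (hin hz))) hb2 (Metric.mem_closedBall_self hR0) hω).trans ?_
    gcongr
    exact mem_closedBall_iff_norm.1 hω
  -- Mean value inequality for `h - ω h'(ω₀)`, whose derivative is `O(R)` on the ball.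
  have key := hconv.norm_image_sub_le_of_norm_hasDerivWithin_le
    (f := fun ω => h ω - ω * deriv h ω₀) (f' := fun ω => deriv h ω - deriv h ω₀)
    (fun ω hω => ((hdiff ω hω).hasDerivAt.sub
      (by simpa using (hasDerivAt_id ω).mul_const (deriv h ω₀))).hasDerivWithinAt) hderiv h₂ h₁
  refine le_trans (le_of_eq ?_) key
  congr 1
  ring

theorem HypW1.memLp {d : ℕ} {W : Rd d → ℂ → ℂ} {ω₀ ω : ℂ} {δ : ℝ} (h : HypW1 W ω₀ δ)
    (hω : ω ∈ Metric.ball ω₀ δ) : MemLp (fun x => W x ω) ∞ (volume : Measure (Rd d)) := by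
  obtain ⟨-, c, -, hb⟩ := h
  exact ⟨(hb ω hω).1, (hb ω hω).2.trans_lt ENNReal.ofReal_lt_top⟩

/-- Measurability is known only for each fixed `ω`, so the derivative is obtained as an a.e. limit
of difference quotients along a sequence `t n → 0`; boundedness is Cauchy's estimate. -/
theorem HypW1.memLp_dW {d : ℕ} {W : Rd d → ℂ → ℂ} {ω₀ : ℂ} {δ : ℝ} (hδ : 0 < δ)
    (h : HypW1 W ω₀ δ) : MemLp (dW W ω₀) ∞ (volume : Measure (Rd d)) := by
  obtain ⟨c, hc, hae⟩ := h.ae_bound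
  have hpos : ∀ n : ℕ, 0 < δ / 2 / ((n : ℝ) + 1) := fun n => by positivity
  have hlt : ∀ n : ℕ, δ / 2 / ((n : ℝ) + 1) < δ := fun n => by
    have : δ / 2 / ((n : ℝ) + 1) ≤ δ / 2 := div_le_self (by positivity) (by simp)
    linarith
  let t : ℕ → ℂ := fun n => ((δ / 2 / ((n : ℝ) + 1) : ℝ) : ℂ)
  have ht : ∀ n, ω₀ + t n ∈ Metric.ball ω₀ δ := fun n => by
    rw [mem_ball_iff_norm, add_sub_cancel_left, Complex.norm_real, Real.norm_of_nonneg (hpos n).le]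
    exact hlt n
  have ht0 : Filter.Tendsto t Filter.atTop (nhdsWithin 0 {0}ᶜ) := by
    refine tendsto_nhdsWithin_iff.2 ⟨?_, Filter.Eventually.of_forall fun n => ?_⟩
    · have h1 : Filter.Tendsto (fun n : ℕ => δ / 2 / ((n : ℝ) + 1)) Filter.atTop (nhds 0) := by
        have := (tendsto_one_div_add_atTop_nhds_zero_nat (𝕜 := ℝ)).const_mul (δ / 2)
        simpa [div_eq_mul_inv] using this
      exact (Complex.continuous_ofReal.tendsto' 0 0 Complex.ofReal_zero).comp h1
    · simpa [t] using (by exact_mod_cast (hpos n).ne' : ((δ / 2 / ((n : ℝ) + 1) : ℝ) : ℂ) ≠ 0)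
  have hmeas : AEStronglyMeasurable (dW W ω₀) (volume : Measure (Rd d)) := by
    refine aestronglyMeasurable_of_tendsto_ae Filter.atTop
      (f := fun n x => (t n)⁻¹ • (W x (ω₀ + t n) - W x ω₀)) (fun n => ?_) ?_
    · exact (((h.memLp (ht n)).1).sub (h.memLp (Metric.mem_ball_self hδ)).1).const_smul (t n)⁻¹
    · filter_upwards [hae] with x hx
      have hda : DifferentiableAt ℂ (W x) ω₀ :=
        hx.1.differentiableAt (Metric.isOpen_ball.mem_nhds (Metric.mem_ball_self hδ))
      exact (hasDerivAt_iff_tendsto_slope_zero.1 hda.hasDerivAt).comp ht0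
  refine memLp_top_of_bound hmeas (c / (δ / 2)) ?_
  filter_upwards [hae] with x hx
  exact norm_deriv_le_of_norm_le (by linarith) (by linarith) hx.1 hx.2

/-- First-order expansion of `ω ↦ W(·, ω)` at `ω₀` in operator norm, in Lipschitz form. -/
theorem HypW1.exists_norm_mulOp_sub_le {d : ℕ} {W : Rd d → ℂ → ℂ} {ω₀ : ℂ} {δ : ℝ} (hδ : 0 < δ)
    (h : HypW1 W ω₀ δ) :
    ∃ C ≥ 0, ∀ R ≤ δ / 4, ∀ ω₁ ∈ Metric.closedBall ω₀ R, ∀ ω₂ ∈ Metric.closedBall ω₀ R,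
      ‖mulOp (fun x => W x ω₁) - mulOp (fun x => W x ω₂) - (ω₁ - ω₂) • mulOp (dW W ω₀)‖
        ≤ C * R * ‖ω₁ - ω₂‖ := by
  obtain ⟨c, hc, hae⟩ := h.ae_bound
  refine ⟨c / (δ / 4) / (δ / 4), by positivity, fun R hR ω₁ h₁ ω₂ h₂ => ?_⟩
  have hR0 : 0 ≤ R := dist_nonneg.trans h₁
  have hin : Metric.closedBall ω₀ R ⊆ Metric.ball ω₀ δ :=
    Metric.closedBall_subset_ball (by linarith)
  rw [mulOp_sub_sub_smul _ (h.memLp (hin h₁)) (h.memLp (hin h₂)) (h.memLp_dW hδ)]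
  refine norm_mulOp_le (by positivity) ?_
  filter_upwards [hae] with x hx
  exact norm_sub_sub_mul_deriv_le hδ hR hx.1 hx.2 h₁ h₂

/-! ### Algebra of `L(·, ω)`, the pairing and the graph norm. -/

theorem linOp_apply {d : ℕ} (A : Op d) (W : Rd d → ℂ → ℂ) (ω : ℂ) (u : A.domain) :
    linOp A W ω u = A u - mulOp (fun x => W x ω) (u : L2 d) := rfl

theorem linOp_add {d : ℕ} (A : Op d) (W : Rd d → ℂ → ℂ) (ω : ℂ) (u v : A.domain) :
    linOp A W ω (u + v : A.domain) = linOp A W ω u + linOp A W ω v :=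
  (linOp A W ω).map_add u v

theorem linOp_sub {d : ℕ} (A : Op d) (W : Rd d → ℂ → ℂ) (ω : ℂ) (u v : A.domain) :
    linOp A W ω (u - v : A.domain) = linOp A W ω u - linOp A W ω v :=
  (linOp A W ω).map_sub u v

theorem linOp_smul {d : ℕ} (A : Op d) (W : Rd d → ℂ → ℂ) (ω z : ℂ) (u : A.domain) :
    linOp A W ω (z • u : A.domain) = z • linOp A W ω u :=
  (linOp A W ω).map_smul z u

theorem pair_add {d : ℕ} (u v w : L2 d) : pair (u + v) w = pair u w + pair v w :=
  inner_add_right _ _ _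

theorem pair_sub {d : ℕ} (u v w : L2 d) : pair (u - v) w = pair u w - pair v w :=
  inner_sub_right _ _ _

theorem pair_smul {d : ℕ} (z : ℂ) (u w : L2 d) : pair (z • u) w = z * pair u w :=
  inner_smul_right _ _ _

theorem norm_pair_le {d : ℕ} (u w : L2 d) : ‖pair u w‖ ≤ ‖w‖ * ‖u‖ :=
  norm_inner_le_norm _ _

theorem graphNorm_nonneg {d : ℕ} (A : Op d) (u : A.domain) : 0 ≤ graphNorm A u :=
  add_nonneg (norm_nonneg _) (norm_nonneg _)

theorem norm_le_graphNorm {d : ℕ} (A : Op d) (u : A.domain) : ‖(u : L2 d)‖ ≤ graphNorm A u :=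
  le_add_of_nonneg_right (norm_nonneg _)

theorem graphNorm_add_le {d : ℕ} (A : Op d) (u v : A.domain) :
    graphNorm A (u + v) ≤ graphNorm A u + graphNorm A v := by
  have h1 := norm_add_le (u : L2 d) v
  have h2 := norm_add_le (A u) (A v)
  simp only [graphNorm, A.map_add, Submodule.coe_add]
  linarith

theorem graphNorm_smul {d : ℕ} (A : Op d) (z : ℂ) (u : A.domain) :
    graphNorm A (z • u) = ‖z‖ * graphNorm A u := by
  simp only [graphNorm, A.map_smul, Submodule.coe_smul, norm_smul]
  ring

/-! ### Fredholm theory of `L(·, ω₀)`. -/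

section LinearSolver

variable {d : ℕ} {A : Op d} {W : Rd d → ℂ → ℂ} {ω₀ : ℂ} {φ₀ : A.domain} {φs : L2 d}

theorem pair_linOp_eq_zero (hdense : Dense (A.domain : Set (L2 d)))
    (hφs : ∃ h : φs ∈ (linOp A W ω₀)†.domain, (linOp A W ω₀)† ⟨φs, h⟩ = 0) (u : A.domain) :
    pair (linOp A W ω₀ u) φs = 0 := by
  obtain ⟨h, h0⟩ := hφs
  have := LinearPMap.adjoint_isFormalAdjoint (T := linOp A W ω₀) hdense ⟨φs, h⟩ u
  rw [h0, inner_zero_left] at this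
  exact this.symm

theorem linOp_eq_zero_of_simple (hsimple : AlgSimple (linOp A W ω₀) (φ₀ : L2 d)) :
    linOp A W ω₀ φ₀ = 0 := by
  have : (φ₀ : L2 d) ∈ (Submodule.span ℂ {(φ₀ : L2 d)} : Set (L2 d)) :=
    Submodule.mem_span_singleton_self _
  rw [← hsimple.1] at this
  exact this.2

/-- `L(·, ω₀)` is injective on `D(A) ∩ ⟨φ₀*⟩^⊥`. -/
theorem eq_zero_of_linOp_eq_zero (hsimple : AlgSimple (linOp A W ω₀) (φ₀ : L2 d))
    (hnorm : pair (φ₀ : L2 d) φs = 1) {u : A.domain} (hu : pair (u : L2 d) φs = 0)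
    (h : linOp A W ω₀ u = 0) : u = 0 := by
  have : (u : L2 d) ∈ (Submodule.span ℂ {(φ₀ : L2 d)} : Set (L2 d)) := by
    rw [← hsimple.1]
    exact ⟨u.2, h⟩
  obtain ⟨c, hc⟩ := Submodule.mem_span_singleton.1 this
  rw [← hc, pair_smul, hnorm, mul_one] at hu
  ext1
  simp [← hc, hu]

/-- The bounded inverse of `L(·, ω₀) : D(A) ∩ ⟨φ₀*⟩^⊥ → range L(·, ω₀)`. -/
theorem exists_bound_linOp (hclosed : A.IsClosed)
    (hsimple : AlgSimple (linOp A W ω₀) (φ₀ : L2 d))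
    (hrange : IsClosed (Set.range (linOp A W ω₀)))
    (hnorm : pair (φ₀ : L2 d) φs = 1) :
    ∃ C > 0, ∀ u : A.domain, pair (u : L2 d) φs = 0 → ‖(u : L2 d)‖ ≤ C * ‖linOp A W ω₀ u‖ := by
  let R : Submodule ℂ (L2 d) := LinearMap.range (linOp A W ω₀).toFun
  let X : Submodule ℂ A.domain :=
    LinearMap.ker ((innerSL ℂ φs).toLinearMap ∘ₗ A.domain.subtype)
  have hX : ∀ u : A.domain, u ∈ X ↔ pair (u : L2 d) φs = 0 := fun u => Iff.rfl
  have hRc : IsClosed (R : Set (L2 d)) := hrange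
  have : CompleteSpace R := hRc.completeSpace_coe
  let T : X →ₗ[ℂ] R := (linOp A W ω₀).toFun.rangeRestrict ∘ₗ X.subtype
  have hT : ∀ u : X, (T u : L2 d) = linOp A W ω₀ (u : A.domain) := fun u => rfl
  have hbij : Function.Bijective T := by
    constructor
    · rw [← LinearMap.ker_eq_bot, LinearMap.ker_eq_bot']
      intro u hu
      have h1 : linOp A W ω₀ (u : A.domain) = 0 := by rw [← hT, hu]; rfl
      exact Subtype.ext (eq_zero_of_linOp_eq_zero hsimple hnorm u.2 h1)
    · rintro ⟨v, u, hu⟩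
      change linOp A W ω₀ u = v at hu
      let u : A.domain := u
      have hmem : u - pair (u : L2 d) φs • φ₀ ∈ X := by
        rw [hX]
        change pair ((u : L2 d) - pair (u : L2 d) φs • (φ₀ : L2 d)) φs = 0
        rw [pair_sub, pair_smul, hnorm, mul_one, sub_self]
      refine ⟨⟨_, hmem⟩, Subtype.ext ?_⟩
      rw [hT]
      change linOp A W ω₀ (u - pair (u : L2 d) φs • φ₀ : A.domain) = v
      rw [linOp_sub, linOp_smul, linOp_eq_zero_of_simple hsimple, smul_zero, sub_zero, hu]
  let e : X ≃ₗ[ℂ] R := LinearEquiv.ofBijective T hbij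
  let S : R →ₗ[ℂ] L2 d := A.domain.subtype ∘ₗ X.subtype ∘ₗ e.symm.toLinearMap
  -- Closed graph theorem between Banach spaces; the domain `R` is complete because the range is
  -- closed. The graph of `S` is closed because that of `A` is and `W(·, ω₀)` acts boundedly.
  have hS : Continuous S := by
    refine LinearMap.continuous_of_isClosed_graph S ?_
    have hgraph : (S.graph : Set (R × L2 d)) =
        {p : R × L2 d | (p.2, (p.1 : L2 d) + mulOp (fun x => W x ω₀) p.2) ∈ (A.graph : Set _)} ∩
          {p : R × L2 d | inner ℂ φs p.2 = 0} := by
      ext ⟨v, s⟩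
      simp only [SetLike.mem_coe, LinearMap.mem_graph_iff, Set.mem_inter_iff, Set.mem_ofPred_eq]
      constructor
      · intro hs
        have hTe : linOp A W ω₀ (e.symm v : A.domain) = v := by
          rw [← hT]
          exact congrArg Subtype.val (e.apply_symm_apply v)
        have hse : s = ((e.symm v : A.domain) : L2 d) := hs
        refine ⟨(LinearPMap.mem_graph_iff _).2 ⟨(e.symm v : A.domain), hse.symm, ?_⟩, ?_⟩
        · change A (e.symm v : A.domain) = (v : L2 d) + mulOp (fun x => W x ω₀) s
          rw [← hTe, linOp_apply, hse]
          abel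
        · rw [hse]
          exact (e.symm v).2
      · rintro ⟨h1, h2⟩
        obtain ⟨y, hy, hy'⟩ := (LinearPMap.mem_graph_iff _).1 h1
        change (y : L2 d) = s at hy
        change A y = (v : L2 d) + mulOp (fun x => W x ω₀) s at hy'
        have hyX : y ∈ X := by
          rw [hX, hy]
          exact h2
        have hev : e ⟨y, hyX⟩ = v := by
          refine Subtype.ext ?_
          change linOp A W ω₀ y = v
          rw [linOp_apply, hy', hy]
          abel
        change s = ((e.symm v : A.domain) : L2 d)
        rw [← hev, e.symm_apply_apply, hy]
    rw [hgraph]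
    refine IsClosed.inter (hclosed.preimage ?_) (isClosed_eq ?_ continuous_const) <;> fun_prop
  let S' : R →L[ℂ] L2 d := ⟨S, hS⟩
  refine ⟨‖S'‖ + 1, by positivity, fun u hu => ?_⟩
  have h1 : S' (e ⟨u, hu⟩) = u := by
    change ((e.symm (e ⟨u, hu⟩) : A.domain) : L2 d) = u
    rw [e.symm_apply_apply]
  calc ‖(u : L2 d)‖ = ‖S' (e ⟨u, hu⟩)‖ := by rw [h1]
    _ ≤ ‖S'‖ * ‖e ⟨u, hu⟩‖ := S'.le_opNorm _
    _ = ‖S'‖ * ‖linOp A W ω₀ u‖ := rfl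
    _ ≤ (‖S'‖ + 1) * ‖linOp A W ω₀ u‖ := by gcongr; linarith

/-- `range L(·, ω₀) = ⟨φ₀*⟩^⊥`: since `L(·, ω)` is invertible for `ω ≠ ω₀` close to `ω₀`, the
cokernel of `L(·, ω₀)` is one-dimensional. -/
theorem exists_linOp_eq {δ : ℝ} (hδ : 0 < δ) (hA1 : HypA1 A) (hW1 : HypW1 W ω₀ δ)
    (hsimple : AlgSimple (linOp A W ω₀) (φ₀ : L2 d)) (hisol : Isolated A W ω₀)
    (hrange : IsClosed (Set.range (linOp A W ω₀)))
    (hφs : ∃ h : φs ∈ (linOp A W ω₀)†.domain, (linOp A W ω₀)† ⟨φs, h⟩ = 0)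
    (hnorm : pair (φ₀ : L2 d) φs = 1) {v : L2 d} (hv : pair v φs = 0) :
    ∃ u : A.domain, pair (u : L2 d) φs = 0 ∧ linOp A W ω₀ u = v := by
  obtain ⟨C, hC, hbound⟩ := exists_bound_linOp hA1.2.1 hsimple hrange hnorm
  let R : Submodule ℂ (L2 d) := LinearMap.range (linOp A W ω₀).toFun
  have hRc : IsClosed (R : Set (L2 d)) := hrange
  have : CompleteSpace R := hRc.completeSpace_coe
  have hRmem : ∀ u : A.domain, linOp A W ω₀ u ∈ R := fun u => ⟨u, rfl⟩
  have hsR : φs ∈ Rᗮ := by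
    rw [Submodule.mem_orthogonal']
    rintro _ ⟨u, rfl⟩
    exact pair_linOp_eq_zero hA1.1 hφs u
  -- a point `ω ≠ ω₀` where `L(·, ω)` is invertible and close to `L(·, ω₀)`
  obtain ⟨ω, hinv, hsmall⟩ : ∃ ω, InResolvent (linOp A W ω) 0 ∧
      C * ‖mulOp (fun x => W x ω) - mulOp (fun x => W x ω₀)‖ < 1 := by
    obtain ⟨ρ, hρ, hiso⟩ := hisol
    obtain ⟨M, hM, hWexp⟩ := hW1.exists_norm_mulOp_sub_le hδ
    let D := M * (δ / 4) + ‖mulOp (dW W ω₀)‖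
    have hD : 0 ≤ D := by positivity
    -- The three bounds serve isolation, the Taylor estimate, and `C * D * t ≤ 1/2`; `D + 1` avoids
    -- a zero denominator.
    let t : ℝ := min (ρ / 2) (min (δ / 4) (1 / (2 * C * (D + 1))))
    have ht : 0 < t := by positivity
    have htρ : t < ρ := (min_le_left _ _).trans_lt (by linarith)
    have htδ : t ≤ δ / 4 := (min_le_right _ _).trans (min_le_left _ _)
    have htC : t ≤ 1 / (2 * C * (D + 1)) := (min_le_right _ _).trans (min_le_right _ _)
    have hnt : ‖ω₀ + (t : ℂ) - ω₀‖ = t := by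
      rw [add_sub_cancel_left, Complex.norm_real, Real.norm_of_nonneg ht.le]
    refine ⟨ω₀ + (t : ℂ), ?_, ?_⟩
    · have h1 := (hiso (ω₀ + (t : ℂ)) (by rw [mem_ball_iff_norm, hnt]; exact htρ)).1
      by_contra hcon
      have : (t : ℂ) = 0 := by simpa using h1 hcon
      exact ht.ne' (by exact_mod_cast this)
    · have h1 := hWexp (δ / 4) le_rfl (ω₀ + (t : ℂ))
        (by rw [mem_closedBall_iff_norm, hnt]; exact htδ) ω₀
        (Metric.mem_closedBall_self (by positivity))
      have h2 : ‖mulOp (fun x => W x (ω₀ + (t : ℂ))) - mulOp (fun x => W x ω₀)‖ ≤ D * t := by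
        have h3 := norm_le_norm_sub_add (mulOp (fun x => W x (ω₀ + (t : ℂ)))
          - mulOp (fun x => W x ω₀)) ((ω₀ + (t : ℂ) - ω₀) • mulOp (dW W ω₀))
        rw [norm_smul] at h3
        rw [hnt] at h1 h3
        calc _ ≤ _ := h3
          _ ≤ M * (δ / 4) * t + t * ‖mulOp (dW W ω₀)‖ := by gcongr
          _ = D * t := by ring
      calc _ ≤ C * (D * t) := by gcongr
        _ ≤ C * (D * (1 / (2 * C * (D + 1)))) := by gcongr
        _ = D / (D + 1) / 2 := by field_simp
        _ ≤ 1 / 2 := by gcongr; rw [div_le_one (by positivity)]; linarith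
        _ < 1 := by norm_num
  -- the image of `D(A) ∩ ⟨φ₀*⟩^⊥` under `L(·, ω)` meets `Rᗮ` trivially
  have htriv : ∀ u : A.domain, pair (u : L2 d) φs = 0 → linOp A W ω u ∈ Rᗮ →
      linOp A W ω u = 0 := by
    intro u hu hmem
    let k := mulOp (fun x => W x ω) (u : L2 d) - mulOp (fun x => W x ω₀) (u : L2 d)
    have hdecomp : linOp A W ω₀ u = linOp A W ω u + k := by
      simp only [linOp_apply, k]
      abel
    -- `L(·, ω) u ⊥ R` while `L(·, ω₀) u ∈ R`, so `‖L(·, ω₀) u‖² = ⟨k, L(·, ω₀) u⟩`. As `k` is small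
    -- against `u`, the lower bound for `L(·, ω₀)` forces `u = 0`.
    have hle : ‖linOp A W ω₀ u‖ ≤ ‖k‖ := by
      have h0 : inner ℂ (linOp A W ω u) (linOp A W ω₀ u) = 0 :=
        (Submodule.mem_orthogonal' _ _).1 hmem _ (hRmem u)
      have h1 : inner ℂ (linOp A W ω₀ u) (linOp A W ω₀ u) = inner ℂ k (linOp A W ω₀ u) := by
        conv_lhs => rw [hdecomp, inner_add_left, ← hdecomp, h0, zero_add]
      have h2 : ‖linOp A W ω₀ u‖ * ‖linOp A W ω₀ u‖ ≤ ‖k‖ * ‖linOp A W ω₀ u‖ := by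
        have h3 : ‖inner ℂ (linOp A W ω₀ u) (linOp A W ω₀ u)‖ =
            ‖linOp A W ω₀ u‖ * ‖linOp A W ω₀ u‖ := by
          rw [inner_self_eq_norm_sq_to_K]
          simp [sq]
        rw [← h3, h1]
        exact norm_inner_le_norm _ _
      rcases (norm_nonneg (linOp A W ω₀ u)).eq_or_lt with h3 | h3
      · rw [← h3]; exact norm_nonneg _
      · exact le_of_mul_le_mul_right h2 h3
    have hk : ‖k‖ ≤ ‖mulOp (fun x => W x ω) - mulOp (fun x => W x ω₀)‖ * ‖(u : L2 d)‖ :=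
      (mulOp (fun x => W x ω) - mulOp (fun x => W x ω₀)).le_opNorm (u : L2 d)
    have hu0 : (u : L2 d) = 0 := by
      by_contra hne
      have hpos : 0 < ‖(u : L2 d)‖ := norm_pos_iff.2 hne
      have := calc ‖(u : L2 d)‖ ≤ C * ‖linOp A W ω₀ u‖ := hbound u hu
        _ ≤ C * (‖mulOp (fun x => W x ω) - mulOp (fun x => W x ω₀)‖ * ‖(u : L2 d)‖) := by
          gcongr; exact hle.trans hk
        _ = C * ‖mulOp (fun x => W x ω) - mulOp (fun x => W x ω₀)‖ * ‖(u : L2 d)‖ := by ring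
        _ < 1 * ‖(u : L2 d)‖ := by gcongr
      linarith
    have : u = 0 := Subtype.ext hu0
    rw [this]
    exact (linOp A W ω).map_zero
  -- decompose preimages under `L(·, ω)` along `φ₀`
  have hsurj : ∀ y : L2 d, ∃ (c : ℂ) (u : A.domain), pair (u : L2 d) φs = 0 ∧
      linOp A W ω u + c • linOp A W ω φ₀ = y := by
    intro y
    obtain ⟨Q, hQ, -⟩ := hinv
    obtain ⟨hq, hq'⟩ := hQ y
    rw [zero_smul, sub_zero] at hq'
    let q : A.domain := ⟨Q y, hq⟩
    change linOp A W ω q = y at hq'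
    refine ⟨pair (q : L2 d) φs, q - pair (q : L2 d) φs • φ₀, ?_, ?_⟩
    · change pair ((q : L2 d) - pair (q : L2 d) φs • (φ₀ : L2 d)) φs = 0
      rw [pair_sub, pair_smul, hnorm, mul_one, sub_self]
    · rw [linOp_sub, linOp_smul, hq', sub_add_cancel]
  have hφs0 : φs ≠ 0 := by
    rintro rfl
    simp [pair] at hnorm
  -- Two elements of `Rᗮ` have a combination in which the `L(·, ω) φ₀` terms cancel; it vanishes by
  -- `htriv`. So `Rᗮ` is at most a line, and it contains `φs ≠ 0`.
  have hspan : ∀ y ∈ Rᗮ, ∃ c : ℂ, y = c • φs := by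
    intro y hy
    obtain ⟨cs, us, hus, hes⟩ := hsurj φs
    obtain ⟨cy, uy, huy, hey⟩ := hsurj y
    have hcs : cs ≠ 0 := by
      rintro rfl
      rw [zero_smul, add_zero] at hes
      exact hφs0 (hes ▸ htriv us hus (hes ▸ hsR))
    have hcomb : linOp A W ω (cs • uy - cy • us : A.domain) = cs • y - cy • φs := by
      rw [linOp_sub, linOp_smul, linOp_smul, ← hey, ← hes, smul_add, smul_add, smul_smul,
        smul_smul, mul_comm cy cs]
      abel
    have h0 := htriv (cs • uy - cy • us) (by
        change pair (cs • (uy : L2 d) - cy • (us : L2 d)) φs = 0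
        rw [pair_sub, pair_smul, pair_smul, hus, huy, mul_zero, mul_zero, sub_self])
      (by rw [hcomb]; exact Rᗮ.sub_mem (Rᗮ.smul_mem _ hy) (Rᗮ.smul_mem _ hsR))
    rw [hcomb, sub_eq_zero] at h0
    refine ⟨cs⁻¹ * cy, ?_⟩
    rw [mul_smul, ← h0, smul_smul, inv_mul_cancel₀ hcs, one_smul]
  -- A closed subspace is its own double orthogonal complement.
  have hvR : v ∈ R := by
    rw [← Submodule.orthogonal_orthogonal R, Submodule.mem_orthogonal]
    intro y hy
    obtain ⟨c, rfl⟩ := hspan y hy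
    rw [inner_smul_left]
    exact mul_eq_zero_of_right _ hv
  obtain ⟨u, hu⟩ := hvR
  let u : A.domain := u
  change linOp A W ω₀ u = v at hu
  refine ⟨u - pair (u : L2 d) φs • φ₀, ?_, ?_⟩
  · change pair ((u : L2 d) - pair (u : L2 d) φs • (φ₀ : L2 d)) φs = 0
    rw [pair_sub, pair_smul, hnorm, mul_one, sub_self]
  · rw [linOp_sub, linOp_smul, linOp_eq_zero_of_simple hsimple, smul_zero, sub_zero, hu]

/-- Bounded solvability of `L(·, ω₀) ψ = σ w + h` for `(σ, ψ) ∈ ℂ × (D(A) ∩ ⟨φ₀*⟩^⊥)`, for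
every `w` with `⟨w, φ₀*⟩ ≠ 0`. -/
theorem exists_bordered_solver {δ : ℝ} (hδ : 0 < δ) (hA1 : HypA1 A) (hW1 : HypW1 W ω₀ δ)
    (hsimple : AlgSimple (linOp A W ω₀) (φ₀ : L2 d)) (hisol : Isolated A W ω₀)
    (hrange : IsClosed (Set.range (linOp A W ω₀)))
    (hφs : ∃ h : φs ∈ (linOp A W ω₀)†.domain, (linOp A W ω₀)† ⟨φs, h⟩ = 0)
    (hnorm : pair (φ₀ : L2 d) φs = 1) {w : L2 d} (hw : pair w φs ≠ 0) :
    ∃ M > 0, ∃ (s : L2 d → ℂ) (Ψ : L2 d → A.domain),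
      (∀ (h : L2 d) (σ : ℂ) (ψ : A.domain),
        (pair (ψ : L2 d) φs = 0 ∧ linOp A W ω₀ ψ = σ • w + h) ↔ σ = s h ∧ ψ = Ψ h) ∧
      (∀ h₁ h₂, ‖s h₁ - s h₂‖ ≤ M * ‖h₁ - h₂‖) ∧
      ∀ h₁ h₂, graphNorm A (Ψ h₁ - Ψ h₂) ≤ M * ‖h₁ - h₂‖ := by
  obtain ⟨C, hC, hbound⟩ := exists_bound_linOp hA1.2.1 hsimple hrange hnorm
  -- Pairing the equation with `φ₀*` kills `L(·, ω₀) ψ` and forces this value of `σ`.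
  let s : L2 d → ℂ := fun h => -pair h φs / pair w φs
  have hpair : ∀ h, pair (s h • w + h) φs = 0 := fun h => by
    simp only [s]
    rw [pair_add, pair_smul, div_mul_cancel₀ _ hw, neg_add_cancel]
  have hex := fun h => exists_linOp_eq hδ hA1 hW1 hsimple hisol hrange hφs hnorm (hpair h)
  choose Ψ hΨ₁ hΨ₂ using hex
  let B := ‖mulOp (fun x => W x ω₀)‖
  let S := ‖φs‖ / ‖pair w φs‖
  have hs : ∀ h₁ h₂, ‖s h₁ - s h₂‖ ≤ S * ‖h₁ - h₂‖ := fun h₁ h₂ => by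
    have : s h₁ - s h₂ = -pair (h₁ - h₂) φs / pair w φs := by
      simp only [s, pair_sub]
      ring
    rw [this, norm_div, norm_neg]
    calc _ ≤ ‖φs‖ * ‖h₁ - h₂‖ / ‖pair w φs‖ := by gcongr; exact norm_pair_le _ _
      _ = _ := by ring
  -- From `A u = L(·, ω₀) u + W(·, ω₀) u`: `C` bounds `‖u‖`, and `1 + B * C` bounds `‖A u‖`.
  have hgraph : ∀ u : A.domain, pair (u : L2 d) φs = 0 →
      graphNorm A u ≤ (C + 1 + B * C) * ‖linOp A W ω₀ u‖ := by
    intro u hu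
    have h1 := hbound u hu
    have h2 : ‖A u‖ ≤ ‖linOp A W ω₀ u‖ + B * ‖(u : L2 d)‖ := by
      have : A u = linOp A W ω₀ u + mulOp (fun x => W x ω₀) (u : L2 d) := by
        rw [linOp_apply]
        abel
      rw [this]
      exact (norm_add_le _ _).trans (by gcongr; exact ContinuousLinearMap.le_opNorm _ _)
    have h3 : B * ‖(u : L2 d)‖ ≤ B * (C * ‖linOp A W ω₀ u‖) := by gcongr
    unfold graphNorm
    linarith
  have hΨ : ∀ h₁ h₂, graphNorm A (Ψ h₁ - Ψ h₂) ≤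
      (C + 1 + B * C) * (S * ‖w‖ + 1) * ‖h₁ - h₂‖ := by
    intro h₁ h₂
    have h0 : pair ((Ψ h₁ - Ψ h₂ : A.domain) : L2 d) φs = 0 := by
      rw [Submodule.coe_sub, pair_sub, hΨ₁, hΨ₁, sub_self]
    refine (hgraph _ h0).trans ?_
    rw [mul_assoc]
    refine mul_le_mul_of_nonneg_left ?_ (by positivity)
    have : linOp A W ω₀ (Ψ h₁ - Ψ h₂ : A.domain) = (s h₁ - s h₂) • w + (h₁ - h₂) := by
      rw [linOp_sub, hΨ₂, hΨ₂, sub_smul]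
      abel
    rw [this]
    calc _ ≤ ‖s h₁ - s h₂‖ * ‖w‖ + ‖h₁ - h₂‖ := (norm_add_le _ _).trans (by rw [norm_smul])
      _ ≤ S * ‖h₁ - h₂‖ * ‖w‖ + ‖h₁ - h₂‖ := by gcongr; exact hs _ _
      _ = _ := by ring
  refine ⟨S + (C + 1 + B * C) * (S * ‖w‖ + 1), by positivity, s, Ψ, ?_, ?_, ?_⟩
  · intro h σ ψ
    constructor
    · rintro ⟨h1, h2⟩
      have hσ : σ = s h := by
        have h3 := pair_linOp_eq_zero hA1.1 hφs ψ
        rw [h2, pair_add, pair_smul] at h3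
        simp only [s]
        rw [eq_div_iff hw]
        linear_combination h3
      refine ⟨hσ, sub_eq_zero.1 (eq_zero_of_linOp_eq_zero hsimple hnorm (φs := φs) ?_ ?_)⟩
      · rw [Submodule.coe_sub, pair_sub, h1, hΨ₁, sub_self]
      · rw [linOp_sub, h2, hΨ₂, hσ, sub_self]
    · rintro ⟨rfl, rfl⟩
      exact ⟨hΨ₁ h, hΨ₂ h⟩
  · intro h₁ h₂
    refine (hs h₁ h₂).trans ?_
    gcongr
    exact le_add_of_nonneg_right (by positivity)
  · intro h₁ h₂
    refine (hΨ h₁ h₂).trans ?_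
    gcongr
    exact le_add_of_nonneg_left (by positivity)

end LinearSolver

/-! ### The nonlinear superposition operator. -/

open Classical in
/-- The superposition `f(·, ω, φ(·))` as an element of `L²` (zero if it is not in `L²`). -/
noncomputable def superpos {d : ℕ} (f : Rd d → ℂ → ℂ → ℂ) (ω : ℂ) (φ : L2 d) : L2 d :=
  if h : MemLp (fun x => f x ω (φ x)) 2 volume then h.toLp _ else 0

section Superposition

variable {d : ℕ} {A : Op d} {W : Rd d → ℂ → ℂ} {f : Rd d → ℂ → ℂ → ℂ} {g : ℂ → Rd d → ℂ}
  {ω₀ : ℂ} {φ₀ : A.domain} {δ α β lam₀ : ℝ}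

theorem superpos_coeFn {ω : ℂ} {φ : L2 d} (h : MemLp (fun x => f x ω (φ x)) 2 volume) :
    (superpos f ω φ : Rd d → ℂ) =ᵐ[volume] fun x => f x ω (φ x) := by
  rw [superpos, dif_pos h]
  exact h.coeFn_toLp

theorem superpos_smul_coeFn {ω z : ℂ} {φ : L2 d}
    (h : MemLp (fun x => f x ω ((z • φ : L2 d) x)) 2 volume) :
    (superpos f ω (z • φ) : Rd d → ℂ) =ᵐ[volume] fun x => f x ω (z * φ x) := by
  filter_upwards [superpos_coeFn h, Lp.coeFn_smul z φ] with x h1 h2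
  rw [h1, h2, Pi.smul_apply, smul_eq_mul]

theorem solves_iff {ω : ℂ} {φ : A.domain} (h : MemLp (fun x => f x ω ((φ : L2 d) x)) 2 volume) :
    Solves A W f ω φ ↔ linOp A W ω φ = superpos f ω φ := by
  constructor
  · rintro ⟨_, hsol⟩
    exact Lp.ext (hsol.trans (superpos_coeFn h).symm)
  · intro hsol
    refine ⟨φ.2, ?_⟩
    change (linOp A W ω φ : Rd d → ℂ) =ᵐ[volume] _
    rw [hsol]
    exact superpos_coeFn h

/-- (f1) concerns a ball about `0`, but (f2) and (f3) a ball about `φ₀`. Scaling by a small `lam`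
moves the second ball into the first. -/
theorem HypF1.memLp_smul (hf1 : HypF1 A f ω₀ δ) {ω : ℂ} (hω : ω ∈ Metric.ball ω₀ δ)
    {lam : ℝ} (hlam : 0 < lam) (hlam' : lam * (graphNorm A φ₀ + δ) < δ)
    {u : A.domain} (hu : graphNorm A (u - φ₀) < δ) :
    MemLp (fun x => f x ω (((lam : ℂ) • (u : L2 d) : L2 d) x)) 2 volume := by
  refine hf1 ω hω ((lam : ℂ) • u) ?_
  rw [graphNorm_smul, Complex.norm_real, Real.norm_of_nonneg hlam.le]
  have h1 := graphNorm_add_le A (u - φ₀) φ₀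
  rw [sub_add_cancel] at h1
  calc _ ≤ lam * (graphNorm A φ₀ + δ) := by gcongr; linarith
    _ < δ := hlam'

theorem norm_sub_le_of_eLpNorm_le {F G : L2 d} {F' G' : Rd d → ℂ} {c : ℝ} (hc : 0 ≤ c)
    (hF : (F : Rd d → ℂ) =ᵐ[volume] F') (hG : (G : Rd d → ℂ) =ᵐ[volume] G')
    (h : eLpNorm (fun x => F' x - G' x) 2 volume ≤ ENNReal.ofReal c) : ‖F - G‖ ≤ c := by
  rw [Lp.norm_def]
  refine ENNReal.toReal_le_of_le_ofReal hc (le_trans (le_of_eq (eLpNorm_congr_ae ?_)) h)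
  filter_upwards [Lp.coeFn_sub F G, hF, hG] with x h1 h2 h3
  rw [h1, Pi.sub_apply, h2, h3]

/-- Scaled Lipschitz continuity of the superposition operator near `(ω₀, φ₀)`. -/
theorem exists_lipschitz_superpos (hf1 : HypF1 A f ω₀ δ) (hf2 : HypF2 A f ω₀ φ₀ δ α lam₀)
    (hf3 : HypF3 A f ω₀ φ₀ δ α lam₀) :
    ∃ K ≥ 0, ∀ lam : ℝ, 0 < lam → lam < lam₀ → lam * (graphNorm A φ₀ + δ) < δ →
      ∀ ω₁ ∈ Metric.ball ω₀ δ, ∀ ω₂ ∈ Metric.ball ω₀ δ,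
      ∀ u₁ : A.domain, graphNorm A (u₁ - φ₀) < δ → ∀ u₂ : A.domain, graphNorm A (u₂ - φ₀) < δ →
      ‖superpos f ω₁ ((lam : ℂ) • (u₁ : L2 d)) - superpos f ω₂ ((lam : ℂ) • (u₂ : L2 d))‖ ≤
        K * lam ^ (1 / α + 1) * (‖ω₁ - ω₂‖ + ‖(u₁ : L2 d) - u₂‖) := by
  obtain ⟨K₂, hK₂, h2⟩ := hf2
  obtain ⟨K₃, hK₃, h3⟩ := hf3
  refine ⟨K₂ + K₃, by positivity, fun lam hl0 hl1 hl2 ω₁ hω₁ ω₂ hω₂ u₁ hu₁ u₂ hu₂ => ?_⟩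
  have e11 := superpos_smul_coeFn (hf1.memLp_smul hω₁ hl0 hl2 hu₁)
  have e21 := superpos_smul_coeFn (hf1.memLp_smul hω₂ hl0 hl2 hu₁)
  have e22 := superpos_smul_coeFn (hf1.memLp_smul hω₂ hl0 hl2 hu₂)
  have b2 := norm_sub_le_of_eLpNorm_le (by positivity) e11 e21
    (h2 lam ⟨hl0, hl1⟩ ω₁ hω₁ ω₂ hω₂ u₁ hu₁)
  have b3 := norm_sub_le_of_eLpNorm_le (by positivity) e21 e22
    (h3 lam ⟨hl0, hl1⟩ u₁ hu₁ u₂ hu₂ ω₂ hω₂)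
  refine (norm_sub_le_norm_sub_add_norm_sub _
    (superpos f ω₂ ((lam : ℂ) • (u₁ : L2 d))) _).trans ((add_le_add b2 b3).trans ?_)
  have p : 0 ≤ lam ^ (1 / α + 1) := by positivity
  have q1 : 0 ≤ K₃ * lam ^ (1 / α + 1) * ‖ω₁ - ω₂‖ := by positivity
  have q2 : 0 ≤ K₂ * lam ^ (1 / α + 1) * ‖(u₁ : L2 d) - u₂‖ := by positivity
  linarith

/-- The leading-order behaviour of `f(·, ω₀, lam φ₀)` as `lam → 0`. -/
theorem exists_norm_superpos_sub_leading_le (hδ : 0 < δ) (hα : 0 < α) (hβ : 0 < β)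
    (hA2 : HypA2 A) (hf1 : HypF1 A f ω₀ δ) (hf4 : HypF4 f g ω₀ δ α β) :
    ∃ C ≥ 0, ∃ l₁ > 0, ∀ lam : ℝ, 0 < lam → lam < l₁ →
      ‖superpos f ω₀ ((lam : ℂ) • (φ₀ : L2 d)) -
        ((lam ^ (1 / α + 1) : ℝ) : ℂ) • leading (g ω₀) α (φ₀ : L2 d)‖ ≤
        C * lam ^ (1 / α + 1 + β) := by
  obtain ⟨hg, ⟨C, r, hr, hO⟩, -⟩ := hf4
  have hω₀ := Metric.mem_ball_self (x := ω₀) hδ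
  -- (A2) makes `φ₀` bounded, so `lam φ₀(x)` is uniformly small and (f4) applies at a.e. `x`. The
  -- maximum with `1` keeps `m` positive for the quotient `r / m`.
  obtain ⟨m, hm0, hm⟩ : ∃ m > 0, ∀ᵐ x : Rd d, ‖(φ₀ : L2 d) x‖ ≤ m := by
    obtain ⟨c, hc⟩ := hA2
    refine ⟨max (c * graphNorm A φ₀) 1, by positivity, ?_⟩
    have h1 := hc φ₀
    rw [eLpNorm_exponent_top] at h1
    filter_upwards [ae_le_eLpNormEssSup (f := ((φ₀ : L2 d) : Rd d → ℂ)) (μ := volume)] with x hx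
    have h2 := (hx.trans h1).trans (ENNReal.ofReal_le_ofReal (le_max_left _ 1))
    rw [← ofReal_norm] at h2
    exact (ENNReal.ofReal_le_ofReal_iff (by positivity)).1 h2
  have hφm : AEStronglyMeasurable ((φ₀ : L2 d) : Rd d → ℂ) volume := Lp.aestronglyMeasurable _
  have hpow : MemLp (fun x => ((‖(φ₀ : L2 d) x‖ ^ (1 / α) : ℝ) : ℂ)) ∞
      (volume : Measure (Rd d)) := by
    refine memLp_top_of_bound ?_ (m ^ (1 / α)) ?_
    · exact Complex.continuous_ofReal.comp_aestronglyMeasurable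
        ((Real.continuous_rpow_const (by positivity)).comp_aestronglyMeasurable hφm.norm)
    · filter_upwards [hm] with x hx
      rw [Complex.norm_real, Real.norm_of_nonneg (by positivity)]
      gcongr
  have hlead : MemLp (fun x => g ω₀ x * ((‖(φ₀ : L2 d) x‖ ^ (1 / α) : ℝ) : ℂ)) ∞
      (volume : Measure (Rd d)) := hpow.mul (hg ω₀ hω₀).1
  have hgn := graphNorm_nonneg A φ₀
  -- All but one power of `|φ₀|` is bounded by `m`; the last one gives the `L²` norm. The constant
  -- in (f4) may be negative, hence `|C|`.
  refine ⟨|C| * m ^ (1 / α + β) * ‖(φ₀ : L2 d)‖, by positivity,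
    min (r / m) (δ / (graphNorm A φ₀ + δ)), by positivity, fun lam hl0 hl1 => ?_⟩
  have hlr : lam * m < r := (lt_div_iff₀ hm0).1 (hl1.trans_le (min_le_left _ _))
  have hlδ : lam * (graphNorm A φ₀ + δ) < δ :=
    (lt_div_iff₀ (by positivity)).1 (hl1.trans_le (min_le_right _ _))
  have hmem := hf1.memLp_smul hω₀ hl0 hlδ (u := φ₀) (by
    rw [sub_self, ← zero_smul ℂ (0 : A.domain), graphNorm_smul]
    simpa using hδ)
  have key : ‖superpos f ω₀ ((lam : ℂ) • (φ₀ : L2 d)) -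
      ((lam ^ (1 / α + 1) : ℝ) : ℂ) • leading (g ω₀) α (φ₀ : L2 d)‖ ≤
      |C| * m ^ (1 / α + β) * lam ^ (1 / α + 1 + β) * ‖(φ₀ : L2 d)‖ := by
    refine Lp.norm_le_mul_norm_of_ae_le_mul ?_
    filter_upwards [superpos_smul_coeFn hmem, mulOp_coeFn hlead (φ₀ : L2 d), hm, hO ω₀ hω₀,
      Lp.coeFn_sub (superpos f ω₀ ((lam : ℂ) • (φ₀ : L2 d)))
        (((lam ^ (1 / α + 1) : ℝ) : ℂ) • leading (g ω₀) α (φ₀ : L2 d)),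
      Lp.coeFn_smul ((lam ^ (1 / α + 1) : ℝ) : ℂ) (leading (g ω₀) α (φ₀ : L2 d))]
      with x e1 e2 hx hOx e3 e4
    rw [e3, Pi.sub_apply, e4, Pi.smul_apply, e1, leading, e2, smul_eq_mul]
    have hnz : ‖(lam : ℂ) * (φ₀ : L2 d) x‖ = lam * ‖(φ₀ : L2 d) x‖ := by
      rw [norm_mul, Complex.norm_real, Real.norm_of_nonneg hl0.le]
    have h1 := hOx ((lam : ℂ) * (φ₀ : L2 d) x) (by
      rw [hnz]
      exact (mul_le_mul_of_nonneg_left hx hl0.le).trans_lt hlr)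
    rw [hnz, Real.mul_rpow hl0.le (norm_nonneg _), Real.mul_rpow hl0.le (norm_nonneg _)] at h1
    have h2 : ((lam ^ (1 / α + 1) : ℝ) : ℂ) *
        (g ω₀ x * ((‖(φ₀ : L2 d) x‖ ^ (1 / α) : ℝ) : ℂ) * (φ₀ : L2 d) x) =
        g ω₀ x * ((lam ^ (1 / α) * ‖(φ₀ : L2 d) x‖ ^ (1 / α) : ℝ) : ℂ) *
          ((lam : ℂ) * (φ₀ : L2 d) x) := by
      rw [Real.rpow_add_one hl0.ne']
      push_cast
      ring
    rw [h2]
    refine h1.trans ?_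
    have h3 : ‖(φ₀ : L2 d) x‖ ^ (1 / α + 1 + β) =
        ‖(φ₀ : L2 d) x‖ ^ (1 / α + β) * ‖(φ₀ : L2 d) x‖ := by
      rw [← Real.rpow_add_one' (norm_nonneg _) (by positivity)]
      congr 1
      ring
    rw [h3]
    calc C * (lam ^ (1 / α + 1 + β) * (‖(φ₀ : L2 d) x‖ ^ (1 / α + β) * ‖(φ₀ : L2 d) x‖))
        ≤ |C| * (lam ^ (1 / α + 1 + β) * (m ^ (1 / α + β) * ‖(φ₀ : L2 d) x‖)) := by
          gcongr
          exact le_abs_self C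
      _ = _ := by ring
  exact key.trans (le_of_eq (by ring))

end Superposition

/-! ### The contraction argument. -/

/-- Banach's fixed point theorem on a closed ball, with contraction constant `1/2`. -/
theorem existsUnique_fixedPoint_closedBall {E : Type*} [NormedAddCommGroup E] [CompleteSpace E]
    {Φ : E → E} {r : ℝ} (hr : 0 ≤ r) (hmaps : ∀ x, ‖x‖ ≤ r → ‖Φ x‖ ≤ r)
    (hlip : ∀ x y, ‖x‖ ≤ r → ‖y‖ ≤ r → ‖Φ x - Φ y‖ ≤ 1 / 2 * ‖x - y‖) :
    ∃! x, ‖x‖ ≤ r ∧ Φ x = x := by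
  have hmt : Set.MapsTo Φ (Metric.closedBall 0 r) (Metric.closedBall 0 r) := fun x hx => by
    rw [mem_closedBall_zero_iff] at hx ⊢
    exact hmaps x hx
  have hcon : ContractingWith (1 / 2) (hmt.restrict Φ _ _) := by
    refine ⟨by rw [← NNReal.coe_lt_coe]; norm_num, LipschitzWith.of_dist_le_mul fun x y => ?_⟩
    have h := hlip x y (mem_closedBall_zero_iff.1 x.2) (mem_closedBall_zero_iff.1 y.2)
    simpa [Subtype.dist_eq, dist_eq_norm] using h
  obtain ⟨x, hx, hfix, -⟩ := ContractingWith.exists_fixedPoint'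
    Metric.isClosed_closedBall.isComplete hmt hcon (Metric.mem_closedBall_self hr)
    (edist_ne_top _ _)
  refine ⟨x, ⟨mem_closedBall_zero_iff.1 hx, hfix⟩, fun y ⟨hy, hy'⟩ => ?_⟩
  have h := hlip y x hy (mem_closedBall_zero_iff.1 hx)
  rw [hy', hfix.eq] at h
  have h0 : ‖y - x‖ = 0 := le_antisymm (by linarith) (norm_nonneg _)
  exact sub_eq_zero.1 (norm_eq_zero.1 h0)

/-- The scaled bordered problem `L(·, ω₀) ψ = σ w + ε^{-1-τ} P_ε(ω, u)` with
`ω = ω₀ + εν + ε^{1+τ}σ` and `u = φ₀ + εϕ + ε^{1+τ}ψ` has exactly one small solution, provided that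
`P_ε` has a Lipschitz constant of order `ε` near `(ω₀, φ₀)` and `P_ε(ω₀, φ₀) = O(ε^{1+γ})`. -/
theorem existsUnique_scaled_solution {d : ℕ} {A : Op d} {W : Rd d → ℂ → ℂ} {ω₀ ν : ℂ}
    {φ₀ ϕ : A.domain} {φs w : L2 d} {M : ℝ} (hM : 0 < M) {s : L2 d → ℂ} {Ψ : L2 d → A.domain}
    (hsolve : ∀ (h : L2 d) (σ : ℂ) (ψ : A.domain),
      (pair (ψ : L2 d) φs = 0 ∧ linOp A W ω₀ ψ = σ • w + h) ↔ σ = s h ∧ ψ = Ψ h)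
    (hs : ∀ h₁ h₂, ‖s h₁ - s h₂‖ ≤ M * ‖h₁ - h₂‖)
    (hΨ : ∀ h₁ h₂, graphNorm A (Ψ h₁ - Ψ h₂) ≤ M * ‖h₁ - h₂‖)
    {P : ℝ → ℂ → A.domain → L2 d} {c C γ τ ε₁ : ℝ} (hC : 0 ≤ C) (hε₁ : 0 < ε₁)
    (hc : c = ‖ν‖ + graphNorm A ϕ + 1)
    (hlip : ∀ ε, 0 < ε → ε < ε₁ → ∀ (ω₁ ω₂ : ℂ) (u₁ u₂ : A.domain),
      ‖ω₁ - ω₀‖ ≤ c * ε → ‖ω₂ - ω₀‖ ≤ c * ε →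
      graphNorm A (u₁ - φ₀) ≤ c * ε → graphNorm A (u₂ - φ₀) ≤ c * ε →
      ‖P ε ω₁ u₁ - P ε ω₂ u₂‖ ≤ C * ε * (‖ω₁ - ω₂‖ + graphNorm A (u₁ - u₂)))
    (hP : ∀ ε, 0 < ε → ε < ε₁ → ‖P ε ω₀ φ₀‖ ≤ C * ε ^ (1 + γ))
    (hτ : 0 < τ) (hτ₁ : τ ≤ 1) (hτγ : τ ≤ γ) :
    ∃ r > 0, ∃ ε₀ > 0, ε₀ ≤ ε₁ ∧ ∀ ε : ℝ, 0 < ε → ε < ε₀ →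
      (∀ (σ : ℂ) (ψ : A.domain), ‖σ‖ < r → graphNorm A ψ < r →
        ‖ω₀ + (ε : ℂ) * ν + ((ε ^ (1 + τ) : ℝ) : ℂ) * σ - ω₀‖ ≤ c * ε ∧
        graphNorm A (φ₀ + (ε : ℂ) • ϕ + ((ε ^ (1 + τ) : ℝ) : ℂ) • ψ - φ₀) ≤ c * ε) ∧
      ∃! q : ℂ × A.domain, ‖q.1‖ < r ∧ graphNorm A q.2 < r ∧ pair (q.2 : L2 d) φs = 0 ∧
        linOp A W ω₀ q.2 = q.1 • w + (((ε ^ (1 + τ))⁻¹ : ℝ) : ℂ) •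
          P ε (ω₀ + (ε : ℂ) * ν + ((ε ^ (1 + τ) : ℝ) : ℂ) * q.1)
            (φ₀ + (ε : ℂ) • ϕ + ((ε ^ (1 + τ) : ℝ) : ℂ) • q.2) := by
  have hϕ := graphNorm_nonneg A ϕ
  have hc0 : 0 < c := by rw [hc]; positivity
  -- `C₀` will bound the scaled remainder; the `+ 1` in `r` then places the solver's output in the
  -- open balls of radius `r`.
  let C₀ := C * (2 * c + 1)
  have hC₀ : 0 ≤ C₀ := by positivity
  let r := M * C₀ + 1
  have hr : 0 < r := by positivity
  have hgz : graphNorm A 0 = 0 := by simp [graphNorm]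
  -- `ε < 1` orders the powers of `ε`; the next bound gives `ε^τ r ≤ 1`, so the corrections cost at
  -- most the `+ 1` in `c`; the last gives contraction constant `2CMε ≤ 1/2`.
  refine ⟨r, hr, min ε₁ (min 1 (min ((1 / r) ^ (1 / τ)) (1 / (4 * C * M + 1)))), by positivity,
    min_le_left _ _, fun ε hε hlt => ?_⟩
  obtain ⟨hεε₁, hlt⟩ := lt_min_iff.1 hlt
  obtain ⟨hε1, hlt⟩ := lt_min_iff.1 hlt
  obtain ⟨hεr, hεC⟩ := lt_min_iff.1 hlt
  have hετ : ε ^ τ * r ≤ 1 := by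
    have h1 : ε ^ τ ≤ ((1 / r) ^ (1 / τ)) ^ τ := by gcongr
    rw [← Real.rpow_mul (by positivity), one_div_mul_cancel hτ.ne', Real.rpow_one] at h1
    exact (le_div_iff₀ hr).1 h1
  have hεpow : ε ^ (1 + τ) = ε * ε ^ τ := by rw [Real.rpow_add hε, Real.rpow_one]
  have hpos : 0 < ε ^ (1 + τ) := by positivity
  have hnpow : ‖((ε ^ (1 + τ) : ℝ) : ℂ)‖ = ε ^ (1 + τ) := by
    rw [Complex.norm_real, Real.norm_of_nonneg hpos.le]
  have hnε : ‖(ε : ℂ)‖ = ε := by rw [Complex.norm_real, Real.norm_of_nonneg hε.le]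
  have hsmall : ∀ t < r, ε ^ (1 + τ) * t ≤ ε := fun t ht => by
    calc ε ^ (1 + τ) * t ≤ ε ^ (1 + τ) * r := by gcongr
      _ = ε * (ε ^ τ * r) := by rw [hεpow]; ring
      _ ≤ ε * 1 := by gcongr
      _ = ε := mul_one _
  let om : ℂ → ℂ := fun σ => ω₀ + (ε : ℂ) * ν + ((ε ^ (1 + τ) : ℝ) : ℂ) * σ
  let uu : A.domain → A.domain := fun ψ => φ₀ + (ε : ℂ) • ϕ + ((ε ^ (1 + τ) : ℝ) : ℂ) • ψ
  have hom : ∀ σ : ℂ, ‖σ‖ < r → ‖om σ - ω₀‖ ≤ c * ε := fun σ hσ => by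
    have : om σ - ω₀ = (ε : ℂ) * ν + ((ε ^ (1 + τ) : ℝ) : ℂ) * σ := by simp only [om]; ring
    rw [this]
    refine (norm_add_le _ _).trans ?_
    rw [norm_mul, norm_mul, hnε, hnpow]
    have := hsmall _ hσ
    have : 0 ≤ ε * graphNorm A ϕ := by positivity
    rw [hc]
    linarith
  have huu : ∀ ψ : A.domain, graphNorm A ψ < r → graphNorm A (uu ψ - φ₀) ≤ c * ε := fun ψ hψ => by
    have : uu ψ - φ₀ = (ε : ℂ) • ϕ + ((ε ^ (1 + τ) : ℝ) : ℂ) • ψ := by simp only [uu]; abel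
    rw [this]
    refine (graphNorm_add_le _ _ _).trans ?_
    rw [graphNorm_smul, graphNorm_smul, hnε, hnpow]
    have := hsmall _ hψ
    have : 0 ≤ ε * ‖ν‖ := by positivity
    rw [hc]
    linarith
  let G : ℂ → A.domain → L2 d := fun σ ψ =>
    (((ε ^ (1 + τ))⁻¹ : ℝ) : ℂ) • P ε (om σ) (uu ψ)
  have hninv : ‖(((ε ^ (1 + τ))⁻¹ : ℝ) : ℂ)‖ = (ε ^ (1 + τ))⁻¹ := by
    rw [Complex.norm_real, Real.norm_of_nonneg (by positivity)]
  have hGb : ∀ σ ψ, ‖σ‖ < r → graphNorm A ψ < r → ‖G σ ψ‖ ≤ C₀ := by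
    intro σ ψ hσ hψ
    have h1 := hlip ε hε hεε₁ (om σ) ω₀ (uu ψ) φ₀ (hom σ hσ)
      (by rw [sub_self, norm_zero]; positivity) (huu ψ hψ) (by rw [sub_self, hgz]; positivity)
    have h2 := hP ε hε hεε₁
    have h3 : ε ^ (1 + γ) ≤ ε ^ (1 + τ) :=
      Real.rpow_le_rpow_of_exponent_ge hε hε1.le (by linarith)
    have h4 : ε * ε ≤ ε ^ (1 + τ) := by
      have := Real.rpow_le_rpow_of_exponent_ge hε hε1.le (show 1 + τ ≤ 2 by linarith)
      rw [Real.rpow_two, sq] at this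
      exact this
    have h5 : ‖P ε (om σ) (uu ψ)‖ ≤ C₀ * ε ^ (1 + τ) := by
      calc ‖P ε (om σ) (uu ψ)‖
          ≤ ‖P ε (om σ) (uu ψ) - P ε ω₀ φ₀‖ + ‖P ε ω₀ φ₀‖ := norm_le_norm_sub_add _ _
        _ ≤ C * ε * (c * ε + c * ε) + C * ε ^ (1 + γ) := by
          refine add_le_add (h1.trans ?_) h2
          gcongr
          exacts [hom σ hσ, huu ψ hψ]
        _ = C * (2 * c * (ε * ε) + ε ^ (1 + γ)) := by ring
        _ ≤ C * (2 * c * ε ^ (1 + τ) + ε ^ (1 + τ)) := by gcongr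
        _ = C₀ * ε ^ (1 + τ) := by simp only [C₀]; ring
    simp only [G]
    rw [norm_smul, hninv, inv_mul_le_iff₀ hpos]
    linarith
  -- The factor `ε^{1+τ}` from the increments of `om` and `uu` cancels the prefactor of `G`.
  have hGl : ∀ σ₁ σ₂ ψ₁ ψ₂, ‖σ₁‖ < r → ‖σ₂‖ < r → graphNorm A ψ₁ < r → graphNorm A ψ₂ < r →
      ‖G σ₁ ψ₁ - G σ₂ ψ₂‖ ≤ C * ε * (‖σ₁ - σ₂‖ + graphNorm A (ψ₁ - ψ₂)) := by
    intro σ₁ σ₂ ψ₁ ψ₂ h1 h2 h3 h4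
    have h5 := hlip ε hε hεε₁ _ _ _ _ (hom σ₁ h1) (hom σ₂ h2) (huu ψ₁ h3) (huu ψ₂ h4)
    have e1 : om σ₁ - om σ₂ = ((ε ^ (1 + τ) : ℝ) : ℂ) * (σ₁ - σ₂) := by simp only [om]; ring
    have e2 : uu ψ₁ - uu ψ₂ = ((ε ^ (1 + τ) : ℝ) : ℂ) • (ψ₁ - ψ₂) := by
      simp only [uu, smul_sub]
      abel
    rw [e1, e2, norm_mul, graphNorm_smul, hnpow] at h5
    simp only [G]
    rw [← smul_sub, norm_smul, hninv, inv_mul_le_iff₀ hpos]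
    linarith
  have hs0 : s 0 = 0 ∧ Ψ 0 = 0 := by
    have := (hsolve 0 0 0).1 ⟨by simp [pair], by
      rw [zero_smul, add_zero]
      exact (linOp A W ω₀).map_zero⟩
    exact ⟨this.1.symm, this.2.symm⟩
  have hsb : ∀ h, ‖h‖ ≤ C₀ → ‖s h‖ < r := fun h hh => by
    have h1 := hs h 0
    rw [hs0.1, sub_zero, sub_zero] at h1
    calc ‖s h‖ ≤ M * C₀ := h1.trans (by gcongr)
      _ < r := lt_add_one _
  have hΨb : ∀ h, ‖h‖ ≤ C₀ → graphNorm A (Ψ h) < r := fun h hh => by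
    have h1 := hΨ h 0
    rw [hs0.2, sub_zero, sub_zero] at h1
    calc graphNorm A (Ψ h) ≤ M * C₀ := h1.trans (by gcongr)
      _ < r := lt_add_one _
  refine ⟨fun σ ψ hσ hψ => ⟨hom σ hσ, huu ψ hψ⟩, ?_⟩
  -- The unknown is the inhomogeneity `h = G σ ψ` rather than `(σ, ψ)`, so completeness of `L²`
  -- suffices.
  obtain ⟨h, ⟨hh, hfix⟩, huniq⟩ := existsUnique_fixedPoint_closedBall (r := C₀)
    (Φ := fun h => G (s h) (Ψ h)) hC₀ (fun h hh => hGb _ _ (hsb h hh) (hΨb h hh))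
    (fun h₁ h₂ hh₁ hh₂ => by
      refine (hGl _ _ _ _ (hsb h₁ hh₁) (hsb h₂ hh₂) (hΨb h₁ hh₁) (hΨb h₂ hh₂)).trans ?_
      calc C * ε * (‖s h₁ - s h₂‖ + graphNorm A (Ψ h₁ - Ψ h₂))
          ≤ C * ε * (M * ‖h₁ - h₂‖ + M * ‖h₁ - h₂‖) := by
            gcongr
            exacts [hs _ _, hΨ _ _]
        _ = 2 * C * M * ε * ‖h₁ - h₂‖ := by ring
        _ ≤ 1 / 2 * ‖h₁ - h₂‖ := by
            gcongr
            have h1 := (lt_div_iff₀ (by positivity)).1 hεC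
            linarith)
  refine ⟨(s h, Ψ h), ⟨hsb h hh, hΨb h hh, ?_⟩, ?_⟩
  · have h1 := (hsolve h (s h) (Ψ h)).2 ⟨rfl, rfl⟩
    exact ⟨h1.1, h1.2.trans (congrArg (s h • w + ·) hfix.symm)⟩
  -- Any solution in the open balls yields the fixed point `G σ ψ`, which lies in the closed ball of
  -- radius `C₀`.
  · rintro ⟨σ, ψ⟩ ⟨h1, h2, h3, h4⟩
    obtain ⟨h5, h6⟩ := (hsolve (G σ ψ) σ ψ).1 ⟨h3, h4⟩
    have h7 := huniq (G σ ψ) ⟨hGb σ ψ h1 h2, by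
      rw [← h5, ← h6]⟩
    rw [h7] at h5 h6
    rw [h5, h6]

/-! ### The remainder and the rescaled equation. -/

/-- The part of `ε^{-α} f(·, ω, ε^α u) + (W(·, ω) - W(·, ω₀)) u` that is left after subtraction of
the leading terms `ε g_{ω₀}|φ₀|^{1/α} φ₀` and `(ω - ω₀) ∂_ω W(·, ω₀) φ₀`. -/
noncomputable def remainder {d : ℕ} {A : Op d} (W : Rd d → ℂ → ℂ) (f : Rd d → ℂ → ℂ → ℂ)
    (g : ℂ → Rd d → ℂ) (ω₀ : ℂ) (φ₀ : A.domain) (α ε : ℝ) (ω : ℂ) (u : A.domain) : L2 d :=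
  ((ε ^ α : ℝ) : ℂ)⁻¹ • superpos f ω (((ε ^ α : ℝ) : ℂ) • (u : L2 d)) -
    (ε : ℂ) • leading (g ω₀) α (φ₀ : L2 d) +
    (mulOp (fun x => W x ω) (u : L2 d) - mulOp (fun x => W x ω₀) (u : L2 d) -
      (ω - ω₀) • mulOp (dW W ω₀) (φ₀ : L2 d))

section Remainder

variable {d : ℕ} {A : Op d} {W : Rd d → ℂ → ℂ} {f : Rd d → ℂ → ℂ → ℂ} {g : ℂ → Rd d → ℂ}
  {ω₀ : ℂ} {φ₀ : A.domain} {δ α β lam₀ : ℝ}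

theorem exists_rpow_lt (hα : 0 < α) {t : ℝ} (ht : 0 < t) :
    ∃ ε₁ > 0, ∀ ε, 0 < ε → ε < ε₁ → ε ^ α < t := by
  refine ⟨t ^ (1 / α), by positivity, fun ε hε hlt => ?_⟩
  have h := Real.rpow_lt_rpow hε.le hlt hα
  rwa [← Real.rpow_mul ht.le, one_div_mul_cancel hα.ne', Real.rpow_one] at h

/-- With `lam = ε^α`, the factor `ε^α` cancels against the division of the equation by `ε^α`. The
case `η = 0` serves the Lipschitz bound, `η = β` the error in (f4). -/
theorem rpow_rpow_one_div_add {ε : ℝ} (hα : 0 < α) (hε : 0 < ε) (η : ℝ) :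
    (ε ^ α) ^ (1 / α + 1 + η) = ε ^ α * (ε * ε ^ (α * η)) := by
  rw [← Real.rpow_mul hε.le]
  nth_rewrite 3 [← Real.rpow_one ε]
  rw [← Real.rpow_add hε, ← Real.rpow_add hε]
  congr 1
  field_simp
  ring

/-- The Lipschitz constant of the linear part of the remainder is of order `R` on the balls of
radius `R` about `ω₀` and `φ₀`. -/
theorem HypW1.exists_norm_mulOp_apply_sub_le (hδ : 0 < δ) (hW1 : HypW1 W ω₀ δ) (φ₀ : L2 d) :
    ∃ C ≥ 0, ∀ R : ℝ, R ≤ δ / 4 → R ≤ 1 → ∀ (ω₁ ω₂ : ℂ) (u₁ u₂ : L2 d),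
      ‖ω₁ - ω₀‖ ≤ R → ‖ω₂ - ω₀‖ ≤ R → ‖u₁ - φ₀‖ ≤ R →
      ‖(mulOp (fun x => W x ω₁) u₁ - mulOp (fun x => W x ω₀) u₁ -
          (ω₁ - ω₀) • mulOp (dW W ω₀) φ₀) -
        (mulOp (fun x => W x ω₂) u₂ - mulOp (fun x => W x ω₀) u₂ -
          (ω₂ - ω₀) • mulOp (dW W ω₀) φ₀)‖ ≤ C * R * (‖ω₁ - ω₂‖ + ‖u₁ - u₂‖) := by
  obtain ⟨K, hK, hexp⟩ := hW1.exists_norm_mulOp_sub_le hδ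
  let D := ‖mulOp (dW W ω₀)‖
  refine ⟨K * (‖φ₀‖ + 1) + D + K, by positivity,
    fun R hR hR1 ω₁ ω₂ u₁ u₂ h₁ h₂ hu => ?_⟩
  have hR0 : 0 ≤ R := (norm_nonneg _).trans h₁
  let E := mulOp (fun x => W x ω₁) - mulOp (fun x => W x ω₂) - (ω₁ - ω₂) • mulOp (dW W ω₀)
  let F := mulOp (fun x => W x ω₂) - mulOp (fun x => W x ω₀) - (ω₂ - ω₀) • mulOp (dW W ω₀)
  have hE : ‖E‖ ≤ K * R * ‖ω₁ - ω₂‖ :=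
    hexp R hR ω₁ (mem_closedBall_iff_norm.2 h₁) ω₂ (mem_closedBall_iff_norm.2 h₂)
  have hF : ‖F‖ ≤ K * R * ‖ω₂ - ω₀‖ :=
    hexp R hR ω₂ (mem_closedBall_iff_norm.2 h₂) ω₀ (Metric.mem_closedBall_self hR0)
  -- Each of the four terms is an increment in `ω` or `u` times a factor `O(R)`.
  have hdecomp : (mulOp (fun x => W x ω₁) u₁ - mulOp (fun x => W x ω₀) u₁ -
          (ω₁ - ω₀) • mulOp (dW W ω₀) φ₀) -
        (mulOp (fun x => W x ω₂) u₂ - mulOp (fun x => W x ω₀) u₂ -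
          (ω₂ - ω₀) • mulOp (dW W ω₀) φ₀) =
      E u₁ + (ω₁ - ω₂) • mulOp (dW W ω₀) (u₁ - φ₀) + F (u₁ - u₂) +
        (ω₂ - ω₀) • mulOp (dW W ω₀) (u₁ - u₂) := by
    simp only [E, F, sub_apply, smul_apply, map_sub]
    module
  have hu₁ : ‖u₁‖ ≤ ‖φ₀‖ + 1 := by
    have := norm_le_norm_sub_add u₁ φ₀
    linarith
  rw [hdecomp]
  have n1 : ‖E u₁‖ ≤ K * R * ‖ω₁ - ω₂‖ * (‖φ₀‖ + 1) := by
    refine (E.le_opNorm u₁).trans ?_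
    gcongr
  have n2 : ‖(ω₁ - ω₂) • mulOp (dW W ω₀) (u₁ - φ₀)‖ ≤ ‖ω₁ - ω₂‖ * (D * R) := by
    rw [norm_smul]
    gcongr
    exact ((mulOp (dW W ω₀)).le_opNorm _).trans (by gcongr)
  have n3 : ‖F (u₁ - u₂)‖ ≤ K * R * 1 * ‖u₁ - u₂‖ := by
    refine (F.le_opNorm _).trans ?_
    gcongr
    exact hF.trans (by gcongr; exact h₂.trans hR1)
  have n4 : ‖(ω₂ - ω₀) • mulOp (dW W ω₀) (u₁ - u₂)‖ ≤ R * (D * ‖u₁ - u₂‖) := by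
    rw [norm_smul]
    gcongr
    exact (mulOp (dW W ω₀)).le_opNorm _
  have p1 : 0 ≤ K * R * ‖ω₁ - ω₂‖ := by positivity
  have p2 : 0 ≤ K * (‖φ₀‖ + 1) * R * ‖u₁ - u₂‖ := by positivity
  have := norm_add_le (E u₁ + (ω₁ - ω₂) • mulOp (dW W ω₀) (u₁ - φ₀) + F (u₁ - u₂))
    ((ω₂ - ω₀) • mulOp (dW W ω₀) (u₁ - u₂))
  have := norm_add_le (E u₁ + (ω₁ - ω₂) • mulOp (dW W ω₀) (u₁ - φ₀)) (F (u₁ - u₂))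
  have := norm_add_le (E u₁) ((ω₁ - ω₂) • mulOp (dW W ω₀) (u₁ - φ₀))
  linarith

/-- The `O(ε)` Lipschitz constant comes from (f2), (f3) at amplitude `ε^α` and from the Taylor
estimate with `R = cε`. At `(ω₀, φ₀)` the linear part vanishes and only the error in (f4) is left.
-/
theorem exists_remainder_bounds (hδ : 0 < δ) (hα : 0 < α) (hβ : 0 < β) (hlam₀ : 0 < lam₀)
    (hA2 : HypA2 A) (hW1 : HypW1 W ω₀ δ) (hf1 : HypF1 A f ω₀ δ)
    (hf2 : HypF2 A f ω₀ φ₀ δ α lam₀) (hf3 : HypF3 A f ω₀ φ₀ δ α lam₀)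
    (hf4 : HypF4 f g ω₀ δ α β) {c : ℝ} (hc : 0 < c) :
    ∃ C ≥ 0, ∃ ε₁ > 0,
      (∀ ε, 0 < ε → ε < ε₁ → c * ε < δ ∧ ε ^ α * (graphNorm A φ₀ + δ) < δ) ∧
      (∀ ε, 0 < ε → ε < ε₁ → ∀ (ω₁ ω₂ : ℂ) (u₁ u₂ : A.domain),
        ‖ω₁ - ω₀‖ ≤ c * ε → ‖ω₂ - ω₀‖ ≤ c * ε →
        graphNorm A (u₁ - φ₀) ≤ c * ε → graphNorm A (u₂ - φ₀) ≤ c * ε →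
        ‖remainder W f g ω₀ φ₀ α ε ω₁ u₁ - remainder W f g ω₀ φ₀ α ε ω₂ u₂‖ ≤
          C * ε * (‖ω₁ - ω₂‖ + graphNorm A (u₁ - u₂))) ∧
      ∀ ε, 0 < ε → ε < ε₁ →
        ‖remainder W f g ω₀ φ₀ α ε ω₀ φ₀‖ ≤ C * ε ^ (1 + α * β) := by
  obtain ⟨K, hK, hKlip⟩ := exists_lipschitz_superpos hf1 hf2 hf3
  obtain ⟨C₁, hC₁, l₁, hl₁, hlead⟩ :=
    exists_norm_superpos_sub_leading_le (φ₀ := φ₀) hδ hα hβ hA2 hf1 hf4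
  obtain ⟨C₂, hC₂, hWlip⟩ := hW1.exists_norm_mulOp_apply_sub_le hδ (φ₀ : L2 d)
  have hgn := graphNorm_nonneg A φ₀
  obtain ⟨ε₂, hε₂, hpow⟩ := exists_rpow_lt hα
    (show 0 < min lam₀ (min l₁ (δ / (graphNorm A φ₀ + δ))) by positivity)
  have hsplit : ∀ ε, 0 < ε → ε < min ε₂ (min (δ / 4 / c) (1 / c)) →
      ε ^ α < lam₀ ∧ ε ^ α < l₁ ∧ ε ^ α * (graphNorm A φ₀ + δ) < δ ∧ c * ε ≤ δ / 4 ∧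
        c * ε ≤ 1 := by
    intro ε hε hlt
    obtain ⟨h1, h2⟩ := lt_min_iff.1 hlt
    obtain ⟨h3, h4⟩ := lt_min_iff.1 h2
    obtain ⟨h5, h6⟩ := lt_min_iff.1 (hpow ε hε h1)
    obtain ⟨h7, h8⟩ := lt_min_iff.1 h6
    refine ⟨h5, h7, (lt_div_iff₀ (by positivity)).1 h8, ?_, ?_⟩
    · rw [mul_comm]; exact ((lt_div_iff₀ hc).1 h3).le
    · rw [mul_comm]; exact ((lt_div_iff₀ hc).1 h4).le
  have hninv : ∀ ε : ℝ, 0 < ε → ‖((ε ^ α : ℝ) : ℂ)⁻¹‖ = (ε ^ α)⁻¹ := fun ε hε => by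
    rw [norm_inv, Complex.norm_real, Real.norm_of_nonneg (by positivity)]
  refine ⟨K + C₂ * c + C₁, by positivity, min ε₂ (min (δ / 4 / c) (1 / c)), by positivity,
    ?_, ?_, ?_⟩
  · intro ε hε hlt
    obtain ⟨-, -, h3, h4, -⟩ := hsplit ε hε hlt
    exact ⟨by linarith, h3⟩
  · intro ε hε hlt ω₁ ω₂ u₁ u₂ hω₁ hω₂ hu₁ hu₂
    obtain ⟨h1, -, h3, h4, h5⟩ := hsplit ε hε hlt
    have hcδ : c * ε < δ := by linarith
    have hεα : 0 < ε ^ α := by positivity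
    have hN := hKlip (ε ^ α) hεα h1 h3 ω₁ (mem_ball_iff_norm.2 (hω₁.trans_lt hcδ)) ω₂
      (mem_ball_iff_norm.2 (hω₂.trans_lt hcδ)) u₁ (hu₁.trans_lt hcδ) u₂ (hu₂.trans_lt hcδ)
    have hL := hWlip (c * ε) h4 h5 ω₁ ω₂ u₁ u₂ hω₁ hω₂ ((norm_le_graphNorm A (u₁ - φ₀)).trans hu₁)
    have hpw := rpow_rpow_one_div_add hα hε 0
    rw [mul_zero, Real.rpow_zero, mul_one, add_zero] at hpw
    rw [hpw] at hN
    have hN' : ‖((ε ^ α : ℝ) : ℂ)⁻¹ • (superpos f ω₁ (((ε ^ α : ℝ) : ℂ) • (u₁ : L2 d)) -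
        superpos f ω₂ (((ε ^ α : ℝ) : ℂ) • (u₂ : L2 d)))‖ ≤
        K * ε * (‖ω₁ - ω₂‖ + ‖(u₁ : L2 d) - u₂‖) := by
      rw [norm_smul, hninv ε hε, inv_mul_le_iff₀ hεα]
      linarith
    have hdecomp : remainder W f g ω₀ φ₀ α ε ω₁ u₁ - remainder W f g ω₀ φ₀ α ε ω₂ u₂ =
        ((ε ^ α : ℝ) : ℂ)⁻¹ • (superpos f ω₁ (((ε ^ α : ℝ) : ℂ) • (u₁ : L2 d)) -
          superpos f ω₂ (((ε ^ α : ℝ) : ℂ) • (u₂ : L2 d))) +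
        ((mulOp (fun x => W x ω₁) (u₁ : L2 d) - mulOp (fun x => W x ω₀) (u₁ : L2 d) -
          (ω₁ - ω₀) • mulOp (dW W ω₀) (φ₀ : L2 d)) -
        (mulOp (fun x => W x ω₂) (u₂ : L2 d) - mulOp (fun x => W x ω₀) (u₂ : L2 d) -
          (ω₂ - ω₀) • mulOp (dW W ω₀) (φ₀ : L2 d))) := by
      simp only [remainder, smul_sub]
      abel
    rw [hdecomp]
    have hug : ‖(u₁ : L2 d) - u₂‖ ≤ graphNorm A (u₁ - u₂) := norm_le_graphNorm A (u₁ - u₂)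
    calc _ ≤ K * ε * (‖ω₁ - ω₂‖ + ‖(u₁ : L2 d) - u₂‖) +
          C₂ * (c * ε) * (‖ω₁ - ω₂‖ + ‖(u₁ : L2 d) - u₂‖) :=
        (norm_add_le _ _).trans (add_le_add hN' hL)
      _ = (K + C₂ * c) * ε * (‖ω₁ - ω₂‖ + ‖(u₁ : L2 d) - u₂‖) := by ring
      _ ≤ (K + C₂ * c + C₁) * ε * (‖ω₁ - ω₂‖ + graphNorm A (u₁ - u₂)) :=
        mul_le_mul (mul_le_mul_of_nonneg_right (le_add_of_nonneg_right hC₁) hε.le) (by gcongr)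
          (by positivity) (by positivity)
  · intro ε hε hlt
    obtain ⟨-, h2, -, -, -⟩ := hsplit ε hε hlt
    have hεα : 0 < ε ^ α := by positivity
    have hN := hlead (ε ^ α) hεα h2
    have hpw := rpow_rpow_one_div_add hα hε 0
    rw [mul_zero, Real.rpow_zero, mul_one, add_zero] at hpw
    rw [hpw, rpow_rpow_one_div_add hα hε β] at hN
    have hεC : ((ε ^ α : ℝ) : ℂ) ≠ 0 := by exact_mod_cast hεα.ne'
    have hdecomp : remainder W f g ω₀ φ₀ α ε ω₀ φ₀ =
        ((ε ^ α : ℝ) : ℂ)⁻¹ • (superpos f ω₀ (((ε ^ α : ℝ) : ℂ) • (φ₀ : L2 d)) -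
          ((ε ^ α * ε : ℝ) : ℂ) • leading (g ω₀) α (φ₀ : L2 d)) := by
      rw [smul_sub, smul_smul, Complex.ofReal_mul, inv_mul_cancel_left₀ hεC]
      simp [remainder]
    rw [hdecomp, norm_smul, hninv ε hε, inv_mul_le_iff₀ hεα]
    refine hN.trans ?_
    rw [Real.rpow_add hε, Real.rpow_one]
    have : 0 ≤ (K + C₂ * c) * (ε ^ α * (ε * ε ^ (α * β))) := by positivity
    linarith

/-- The equation `L(·, ω) φ = f(·, ω, φ)` in the scaled unknowns `(σ, ψ)`. -/
theorem linOp_eq_superpos_iff {ϕ ψ : A.domain} {ν ω σ : ℂ} {ε b : ℝ} (hε : 0 < ε) (hb : b ≠ 0)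
    (hφ₀ : linOp A W ω₀ φ₀ = 0)
    (hϕ : linOp A W ω₀ ϕ = leading (g ω₀) α (φ₀ : L2 d) + ν • mulOp (dW W ω₀) (φ₀ : L2 d))
    (hω : ω = ω₀ + (ε : ℂ) * ν + (b : ℂ) * σ) {u : A.domain}
    (hu : u = φ₀ + (ε : ℂ) • ϕ + (b : ℂ) • ψ) :
    linOp A W ω (((ε ^ α : ℝ) : ℂ) • u : A.domain) =
        superpos f ω (((ε ^ α : ℝ) : ℂ) • (u : L2 d)) ↔
      linOp A W ω₀ ψ = σ • mulOp (dW W ω₀) (φ₀ : L2 d) +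
        ((b⁻¹ : ℝ) : ℂ) • remainder W f g ω₀ φ₀ α ε ω u := by
  have ha : ((ε ^ α : ℝ) : ℂ) ≠ 0 := by exact_mod_cast (Real.rpow_pos_of_pos hε α).ne'
  have hb' : (b : ℂ) ≠ 0 := by exact_mod_cast hb
  have hL₀ : linOp A W ω₀ u = (ε : ℂ) • (leading (g ω₀) α (φ₀ : L2 d) +
      ν • mulOp (dW W ω₀) (φ₀ : L2 d)) + (b : ℂ) • linOp A W ω₀ ψ := by
    rw [hu, linOp_add, linOp_add, linOp_smul, linOp_smul, hφ₀, hϕ, zero_add]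
  have hL : linOp A W ω u = linOp A W ω₀ u -
      (mulOp (fun x => W x ω) (u : L2 d) - mulOp (fun x => W x ω₀) (u : L2 d)) := by
    simp only [linOp_apply]
    abel
  have hω' : ω - ω₀ = (ε : ℂ) * ν + (b : ℂ) * σ := by rw [hω]; ring
  -- The terms of order `ε` cancel by the equation for `ϕ`, since `ω - ω₀ = εν + bσ`.
  have key : (b : ℂ) • linOp A W ω₀ ψ - ((b : ℂ) • σ • mulOp (dW W ω₀) (φ₀ : L2 d) +
      remainder W f g ω₀ φ₀ α ε ω u) = ((ε ^ α : ℝ) : ℂ)⁻¹ •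
        (((ε ^ α : ℝ) : ℂ) • linOp A W ω u -
          superpos f ω (((ε ^ α : ℝ) : ℂ) • (u : L2 d))) := by
    rw [smul_sub, inv_smul_smul₀ ha, hL, hL₀, remainder, hω']
    module
  have hscale : linOp A W ω₀ ψ = σ • mulOp (dW W ω₀) (φ₀ : L2 d) +
        ((b⁻¹ : ℝ) : ℂ) • remainder W f g ω₀ φ₀ α ε ω u ↔
      (b : ℂ) • linOp A W ω₀ ψ = (b : ℂ) • σ • mulOp (dW W ω₀) (φ₀ : L2 d) +
        remainder W f g ω₀ φ₀ α ε ω u := by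
    rw [← (smul_right_injective (L2 d) hb').eq_iff, Complex.ofReal_inv]
    simp only [smul_add, smul_inv_smul₀ hb']
  rw [hscale, linOp_smul, ← sub_eq_zero, ← smul_eq_zero_iff_right (inv_ne_zero ha), ← key,
    sub_eq_zero]

end Remainder

end NLEig

/-! ### Assembly of the theorem. -/

open NLEig in
theorem theorem1 {d : ℕ} (A : NLEig.Op d) (W : NLEig.Rd d → ℂ → ℂ)
    (f : NLEig.Rd d → ℂ → ℂ → ℂ) (g : ℂ → NLEig.Rd d → ℂ)
    (ω₀ : ℂ) (φ₀ : A.domain) (φs : NLEig.L2 d)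
    (δ α β lam₀ : ℝ) (hδ : 0 < δ) (hα : 0 < α) (hβ : 0 < β) (hlam₀ : 0 < lam₀)
    (hA1 : NLEig.HypA1 A) (hA2 : NLEig.HypA2 A) (hW1 : NLEig.HypW1 W ω₀ δ)
    -- `ω₀` is an algebraically simple, isolated eigenvalue, and `L(·, ω₀)` has closed range
    (hsimple : NLEig.AlgSimple (NLEig.linOp A W ω₀) (φ₀ : NLEig.L2 d))
    (hisol : NLEig.Isolated A W ω₀)
    (hrange : IsClosed (Set.range (NLEig.linOp A W ω₀)))
    -- normalized eigenfunctions of `L(·, ω₀)` and of its adjoint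
    (hφ₀ : ‖(φ₀ : NLEig.L2 d)‖ = 1)
    (hφs : ∃ h : φs ∈ (NLEig.linOp A W ω₀)†.domain, (NLEig.linOp A W ω₀)† ⟨φs, h⟩ = 0)
    (hnorm : NLEig.pair (φ₀ : NLEig.L2 d) φs = 1)
    (hWt : NLEig.pair (NLEig.mulOp (NLEig.dW W ω₀) (φ₀ : NLEig.L2 d)) φs ≠ 0)
    (hf1 : NLEig.HypF1 A f ω₀ δ) (hf2 : NLEig.HypF2 A f ω₀ φ₀ δ α lam₀)
    (hf3 : NLEig.HypF3 A f ω₀ φ₀ δ α lam₀) (hf4 : NLEig.HypF4 f g ω₀ δ α β) :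
    -- `ϕ` is the unique element of `D(A) ∩ ⟨φ₀*⟩^⊥` with
    -- `L(·, ω₀) ϕ = g_{ω₀}|φ₀|^{1/α} φ₀ + ν ∂_ω W(·, ω₀) φ₀`
    ∃ ϕ : A.domain,
      (∀ η : A.domain,
        (NLEig.pair (η : NLEig.L2 d) φs = 0 ∧
          NLEig.linOp A W ω₀ η = NLEig.leading (g ω₀) α φ₀ +
            NLEig.nu W g α ω₀ φ₀ φs • NLEig.mulOp (NLEig.dW W ω₀) (φ₀ : NLEig.L2 d)) ↔ η = ϕ) ∧
      ∀ τ : ℝ, 0 < τ → τ ≤ min 1 (α * β) →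
        ∃ r₁ > 0, ∃ r₂ > 0, ∃ ε₀ > 0, ∀ ε : ℝ, 0 < ε → ε < ε₀ →
          ∃! p : ℂ × NLEig.L2 d,
            NLEig.Solves A W f p.1 p.2 ∧
            NLEig.pair p.2 φs = ((ε ^ α : ℝ) : ℂ) ∧
            NLEig.HasExpansion A ω₀ (NLEig.nu W g α ω₀ φ₀ φs) φ₀ φs ϕ α τ r₁ r₂ ε p.1 p.2 := by
  obtain ⟨M, hM, s, Ψ, hsolve, hs, hΨ⟩ :=
    exists_bordered_solver hδ hA1 hW1 hsimple hisol hrange hφs hnorm hWt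
  set w : L2 d := mulOp (dW W ω₀) (φ₀ : L2 d) with hw
  set ν : ℂ := nu W g α ω₀ φ₀ φs with hν
  set ld : L2 d := leading (g ω₀) α φ₀ with hld
  -- The solvability condition that determines `ν`.
  have hcompat : pair (ld + ν • w) φs = 0 := by
    rw [pair_add, pair_smul, hν, nu, ← hw, ← hld, div_mul_cancel₀ _ hWt, add_neg_cancel]
  obtain ⟨ϕ, hϕ₁, hϕ₂⟩ :=
    exists_linOp_eq hδ hA1 hW1 hsimple hisol hrange hφs hnorm hcompat
  refine ⟨ϕ, fun η => ⟨fun ⟨h1, h2⟩ => ?_, ?_⟩, fun τ hτ hτle => ?_⟩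
  · refine sub_eq_zero.1 (eq_zero_of_linOp_eq_zero hsimple hnorm (φs := φs) ?_ ?_)
    · rw [Submodule.coe_sub, pair_sub, h1, hϕ₁, sub_self]
    · rw [linOp_sub, h2, hϕ₂, sub_self]
  · rintro rfl
    exact ⟨hϕ₁, hϕ₂⟩
  have hϕn := graphNorm_nonneg A ϕ
  have hc : 0 < ‖ν‖ + graphNorm A ϕ + 1 := by positivity
  obtain ⟨C, hC, ε₁, hε₁, hsmall, hlip, hP⟩ := exists_remainder_bounds (g := g) hδ hα hβ hlam₀
    hA2 hW1 hf1 hf2 hf3 hf4 hc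
  obtain ⟨r, hr, ε₀, hε₀, hle, hmain⟩ := existsUnique_scaled_solution hM hsolve hs hΨ hC hε₁ rfl
    hlip hP hτ (hτle.trans (min_le_left _ _)) (hτle.trans (min_le_right _ _))
  refine ⟨r, hr, r, hr, ε₀, hε₀, fun ε hε hlt => ?_⟩
  obtain ⟨hdom, ⟨σ, ψ⟩, ⟨hσ, hψ, hψs, heq⟩, huniq⟩ := hmain ε hε hlt
  obtain ⟨hcδ, hεδ⟩ := hsmall ε hε (hlt.trans_le hle)
  have hεα : 0 < ε ^ α := by positivity
  have hb : ε ^ (1 + τ) ≠ 0 := by positivity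
  have hfactor : ∀ ψ : A.domain, ((ε ^ α : ℝ) : ℂ) • (φ₀ : L2 d) +
      ((ε ^ (α + 1) : ℝ) : ℂ) • (ϕ : L2 d) + ((ε ^ (α + 1 + τ) : ℝ) : ℂ) • (ψ : L2 d) =
      ((((ε ^ α : ℝ) : ℂ) •
        (φ₀ + (ε : ℂ) • ϕ + ((ε ^ (1 + τ) : ℝ) : ℂ) • ψ) : A.domain) : L2 d) := by
    intro ψ
    rw [add_assoc α 1 τ, Real.rpow_add hε, Real.rpow_add hε α (1 + τ), Real.rpow_one]
    push_cast
    simp only [smul_add, smul_smul]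
  have hiff : ∀ (σ : ℂ) (ψ : A.domain), ‖σ‖ < r → graphNorm A ψ < r →
      (Solves A W f (ω₀ + (ε : ℂ) * ν + ((ε ^ (1 + τ) : ℝ) : ℂ) * σ)
        ((((ε ^ α : ℝ) : ℂ) •
          (φ₀ + (ε : ℂ) • ϕ + ((ε ^ (1 + τ) : ℝ) : ℂ) • ψ) : A.domain) : L2 d) ↔
      linOp A W ω₀ ψ = σ • w + (((ε ^ (1 + τ))⁻¹ : ℝ) : ℂ) •
        remainder W f g ω₀ φ₀ α ε (ω₀ + (ε : ℂ) * ν + ((ε ^ (1 + τ) : ℝ) : ℂ) * σ)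
          (φ₀ + (ε : ℂ) • ϕ + ((ε ^ (1 + τ) : ℝ) : ℂ) • ψ)) := by
    intro σ ψ hσ hψ
    obtain ⟨h1, h2⟩ := hdom σ ψ hσ hψ
    have hmem := hf1.memLp_smul (mem_ball_iff_norm.2 (h1.trans_lt hcδ)) hεα hεδ (h2.trans_lt hcδ)
    rw [solves_iff hmem]
    exact linOp_eq_superpos_iff hε hb (linOp_eq_zero_of_simple hsimple) hϕ₂ rfl rfl
  refine ⟨(ω₀ + (ε : ℂ) * ν + ((ε ^ (1 + τ) : ℝ) : ℂ) * σ,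
    ((((ε ^ α : ℝ) : ℂ) •
      (φ₀ + (ε : ℂ) • ϕ + ((ε ^ (1 + τ) : ℝ) : ℂ) • ψ) : A.domain) : L2 d)),
    ⟨(hiff σ ψ hσ hψ).2 heq, ?_, σ, ψ, hσ, hψ, hψs, rfl, (hfactor ψ).symm⟩, ?_⟩
  -- The constraint holds for every `φ` of the prescribed form, because `ϕ` and `ψ` are orthogonal
  -- to `φ₀*`; uniqueness does not need it.
  · change pair (((ε ^ α : ℝ) : ℂ) • ((φ₀ : L2 d) + (ε : ℂ) • (ϕ : L2 d) +
      ((ε ^ (1 + τ) : ℝ) : ℂ) • (ψ : L2 d))) φs = _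
    rw [pair_smul, pair_add, pair_add, pair_smul, pair_smul, hnorm, hϕ₁, hψs]
    simp
  · rintro ⟨ω, φ⟩ ⟨hsol, -, σ', ψ', hσ', hψ', hψs', rfl, hφ⟩
    rw [hfactor] at hφ
    obtain rfl := hφ
    have h := huniq (σ', ψ') ⟨hσ', hψ', hψs', (hiff σ' ψ' hσ' hψ').1 hsol⟩
    obtain ⟨rfl, rfl⟩ := Prod.mk.inj h
    rfl
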